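/- An area metric on a smooth four-dimensional manifold $M$ is a smooth covariant tensor field $G$ of rank four with $G_{abcd}=G_{cdab}=-G_{bacd}$ whose induced map $\Lambda^2T_pM\to\Lambda^2T_p^*M$ is invertible at every $p$. With respect to a frame, $\mathrm{Petrov}(G)$ is the symmetric $6\times 6$ matrix of $G$ on the index pairs $[01],[02],[03],[12],[31],[23]$, $G^{abcd}$ denotes the tensor with Petrov matrix $\mathrm{Petrov}(G)^{-1}$, $\omega_G=|\det \mathrm{Petrov}(G)|^{1/6}\,\epsilon$ ($\epsilon_{0123}=1$) is the volume form, $\omega_G^{-1}$ is its inverse in the same sense, and $J=\omega_G^{-1}G$ is the associated endomorphism of $\Lambda^2T_pM$. The metaclass of $G$ at $p$ is the Segré type of $J$: the sizes of its Jordan blocks with real eigenvalues and, with a bar, of its pairs of blocks with conjugate non-real eigenvalues. The metaclasses VIII–XXIII are those with at least one real Jordan block of size at least two, namely $[6]$, $[42]$, $[4\,1\bar1]$, $[411]$, $[2\bar2\,2]$, $[222]$, $[22\,1\bar1]$, $[2211]$, $[2\,1\bar1\,1\bar1]$, $[211\,1\bar1]$, $[21111]$, $[51]$, $[33]$, $[321]$,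 $[31\,1\bar1]$, $[3111]$. Given coordinates $(t,x^\alpha)$ around $p$ (a time-space splitting), let $u=(E_\alpha,B^\alpha)$ with $E_\alpha=F_{0\alpha}$ and $B^\alpha=\tfrac12(\omega_G^{-1})^{0\alpha cd}F_{cd}$, and consider on $\mathbb R\times\mathbb R^3$ Maxwell's equations with the coefficients frozen at $p$, $$(\omega_G^{-1})^{abcd}\partial_bF_{cd}=0,\qquad G^{abcd}\partial_bF_{cd}=0 .$$ Their components $a=0$ restricted to $t=0$ are the constraints on initial data. The evolution equations are $\partial_tu=C^\alpha\partial_\alpha u$ with $C^\alpha=-(A^0)^{-1}A^\alpha$, $$A^0=\begin{pmatrix}G^{0\mu0\nu}&0\\0&\delta^\mu_\nu\end{pmatrix},\qquad A^\alpha=\begin{pmatrix}-2G^{0(\mu\nu)\alpha}&-\frac12(\omega_G)_{0\nu\gamma\delta}G^{\gamma\delta\mu\alpha}\\(\omega_G^{-1})^{0\mu\nu\alpha}&0\end{pmatrix},$$ whenever the splitting is noncharacteristic, i.e. $\det A^0\neq0$; for a spatial covector $k=k_\alpha dx^\alpha$ put $C(k)=C^\alpha k_\alpha$. The Cauchy problem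 for Maxwell electrodynamics is called well-posed at $p$ if there is a noncharacteristic splitting and a $\tau>0$ such that, in the class of $C^1$ solutions of Maxwell's frozen equations on $[0,\tau]\times\mathbb R^3$ with $u(t,\cdot)\in L^2$ for all $t\in[0,\tau]$, (i) every Schwartz initial datum satisfying the constraints admits a solution, (ii) a solution is determined on $[0,\tau]$ by its initial datum, and (iii) there is a constant $K$ with $\|u(t,\cdot)\|_{L^2}\le K\|u(0,\cdot)\|_{L^2}$ for all solutions $u$ and all $t\in[0,\tau]$. Theorem. Let $(M,G)$ be a four-dimensional area metric manifold (Hausdorff, second countable), and let $p\in M$ be a point at which $G$ is of one of the metaclasses VIII–XXIII. Then the Cauchy problem for Maxwell electrodynamics is not well-posed at $p$. Moreover, for every noncharacteristic time-space splitting at $p$ there is a spatial covector $k$ for which $C(k)$ is not diagonalizable, even over $\mathbb C$. -/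

import Mathlib

open scoped Manifold ContDiff SchwartzMap NNReal

noncomputable section

/-! ### Area metrics on a four-dimensional manifold -/

/-- Components of a fourth-rank tensor on a four-dimensional space, indices `0, 1, 2, 3`. -/
abbrev Tensor4 := Fin 4 → Fin 4 → Fin 4 → Fin 4 → ℝ

/-- The antisymmetric index pairs `[01], [02], [03], [12], [31], [23]`. -/
def petrovPair : Fin 6 → Fin 4 × Fin 4 :=
  ![(0, 1), (0, 2), (0, 3), (1, 2), (3, 1), (2, 3)]

/-- The `6 × 6` Petrov matrix of a tensor that is antisymmetric in its first and in its last
pair of indices. -/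
def petrov (T : Tensor4) : Matrix (Fin 6) (Fin 6) ℝ :=
  Matrix.of fun A B =>
    T (petrovPair A).1 (petrovPair A).2 (petrovPair B).1 (petrovPair B).2

/-- The sign with which the index pair `(a, b)` is represented by the Petrov index `A`. -/
def petrovSign (A : Fin 6) (a b : Fin 4) : ℝ :=
  if (a, b) = petrovPair A then 1 else if (b, a) = petrovPair A then -1 else 0

/-- The tensor, antisymmetric in both index pairs, with a given Petrov matrix. -/
def unpetrov (K : Matrix (Fin 6) (Fin 6) ℝ) : Tensor4 := fun a b c d =>
  ∑ A, ∑ B, petrovSign A a b * K A B * petrovSign B c d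

/-- The Levi-Civita symbol, `ε₀₁₂₃ = 1`. -/
def leviCivita : Tensor4 := fun a b c d =>
  Matrix.det (Matrix.of fun i j : Fin 4 => if ![a, b, c, d] i = j then (1 : ℝ) else 0)

/-- The inverse tensor: its Petrov matrix is the inverse Petrov matrix. -/
def invTensor (T : Tensor4) : Tensor4 := unpetrov (petrov T)⁻¹

/-- The canonical volume form `ω_G = |det Petrov(G)|^{1/6} ε`. -/
def volForm (G : Tensor4) : Tensor4 := fun a b c d =>
  |(petrov G).det| ^ (1 / 6 : ℝ) * leviCivita a b c d

/-- The endomorphism `J = ω_G⁻¹ G` of the space of bivectors. -/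
def endoJ (G : Tensor4) : Matrix (Fin 6) (Fin 6) ℝ := (petrov (volForm G))⁻¹ * petrov G

/-- An area metric: a smooth fourth-rank covariant tensor field with the symmetries
`G(X,Y,A,B) = G(A,B,X,Y) = -G(Y,X,A,B)` for which the induced map `Λ²T_pM → Λ²T_p*M`,
whose matrix with respect to a frame is the Petrov matrix, is invertible at every point. -/
structure AreaMetric (M : Type*) [TopologicalSpace M]
    [ChartedSpace (EuclideanSpace ℝ (Fin 4)) M] [IsManifold (𝓡 4) ∞ M] where
  /-- the tensor at a point -/
  toFun (p : M) : TangentSpace (𝓡 4) p →ₗ[ℝ] TangentSpace (𝓡 4) p →ₗ[ℝ]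
    TangentSpace (𝓡 4) p →ₗ[ℝ] TangentSpace (𝓡 4) p →ₗ[ℝ] ℝ
  /-- the tensor field is smooth: it maps smooth vector fields to smooth functions -/
  smooth (X Y A B : ∀ p : M, TangentSpace (𝓡 4) p) :
    ContMDiff (𝓡 4) (𝓡 4).tangent ∞ (fun p => (⟨p, X p⟩ : TangentBundle (𝓡 4) M)) →
    ContMDiff (𝓡 4) (𝓡 4).tangent ∞ (fun p => (⟨p, Y p⟩ : TangentBundle (𝓡 4) M)) →
    ContMDiff (𝓡 4) (𝓡 4).tangent ∞ (fun p => (⟨p, A p⟩ : TangentBundle (𝓡 4) M)) →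
    ContMDiff (𝓡 4) (𝓡 4).tangent ∞ (fun p => (⟨p, B p⟩ : TangentBundle (𝓡 4) M)) →
    ContMDiff (𝓡 4) 𝓘(ℝ, ℝ) ∞ (fun p => toFun p (X p) (Y p) (A p) (B p))
  symm (p : M) (X Y A B : TangentSpace (𝓡 4) p) : toFun p X Y A B = toFun p A B X Y
  antisymm (p : M) (X Y A B : TangentSpace (𝓡 4) p) : toFun p X Y A B = -toFun p Y X A B
  invertible (p : M) (e : Module.Basis (Fin 4) ℝ (TangentSpace (𝓡 4) p)) :
    IsUnit (petrov fun a b c d => toFun p (e a) (e b) (e c) (e d)).det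

/-- Components `G_{abcd}` of an area metric at `p` with respect to a frame of `T_pM`. -/
def AreaMetric.components {M : Type*} [TopologicalSpace M]
    [ChartedSpace (EuclideanSpace ℝ (Fin 4)) M] [IsManifold (𝓡 4) ∞ M] (G : AreaMetric M) (p : M)
    (e : Module.Basis (Fin 4) ℝ (TangentSpace (𝓡 4) p)) : Tensor4 :=
  fun a b c d => G.toFun p (e a) (e b) (e c) (e d)

/-! ### Segré types and metaclasses -/

/-- The Jordan block of size `n` with eigenvalue `μ`. -/
def jordanBlock (n : ℕ) (μ : ℂ) : Matrix (Fin n) (Fin n) ℂ :=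
  Matrix.of fun i j => if i = j then μ else if (i : ℕ) + 1 = j then 1 else 0

/-- Sizes of the Jordan blocks belonging to the Segré symbol with real blocks of the sizes `r`
and pairs of complex conjugate blocks of the sizes `c`. -/
def segreSize (r c : List ℕ) : Fin r.length ⊕ Fin c.length ⊕ Fin c.length → ℕ :=
  Sum.elim r.get (Sum.elim c.get c.get)

/-- Eigenvalues of the blocks: real ones for `r`, conjugate pairs for `c`. -/
def segreEigenvalue (r c : List ℕ) (lam : Fin r.length → ℝ) (mu : Fin c.length → ℂ) :
    Fin r.length ⊕ Fin c.length ⊕ Fin c.length → ℂ :=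
  Sum.elim (fun i => (lam i : ℂ)) (Sum.elim mu fun i => (starRingEnd ℂ) (mu i))

/-- `J` has a Jordan normal form with real Jordan blocks of the sizes `r` and, for each entry of
`c`, a pair of Jordan blocks of that size with conjugate non-real eigenvalues. For instance the
Segré symbol `[2 1 1 1 1̄]` is `r = [2, 1, 1]`, `c = [1]`. -/
def HasSegreType (J : Matrix (Fin 6) (Fin 6) ℝ) (r c : List ℕ) : Prop :=
  ∃ (lam : Fin r.length → ℝ) (mu : Fin c.length → ℂ), (∀ i, 0 < (mu i).im) ∧
    ∃ (P : Matrix (Fin 6) (Σ i, Fin (segreSize r c i)) ℂ)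
      (Q : Matrix (Σ i, Fin (segreSize r c i)) (Fin 6) ℂ),
      P * Q = 1 ∧ Q * P = 1 ∧
        J.map Complex.ofReal =
          P * Matrix.blockDiagonal'
            (fun i => jordanBlock (segreSize r c i) (segreEigenvalue r c lam mu i)) * Q

/-- The Segré types (sizes of real blocks, sizes of conjugate pairs) of the metaclasses VIII to
XXIII, in this order; these are all the types with a real block of size at least two. -/
def segreTypesVIIItoXXIII : List (List ℕ × List ℕ) :=
  [([6], []), ([4, 2], []), ([4], [1]), ([4, 1, 1], []), ([2], [2]), ([2, 2, 2], []),
    ([2, 2], [1]), ([2, 2, 1, 1], []), ([2], [1, 1]), ([2, 1, 1], [1]), ([2, 1, 1, 1, 1], []),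
    ([5, 1], []), ([3, 3], []), ([3, 2, 1], []), ([3, 1], [1]), ([3, 1, 1, 1], [])]

/-- The area metric is, at the point `p`, of one of the metaclasses VIII to XXIII. (A change of
frame changes `J` by a similarity and possibly, with the orientation, a sign; the Segré type does
not depend on the frame.) -/
def AreaMetric.IsMetaclassVIIItoXXIIIAt {M : Type*} [TopologicalSpace M]
    [ChartedSpace (EuclideanSpace ℝ (Fin 4)) M] [IsManifold (𝓡 4) ∞ M]
    (G : AreaMetric M) (p : M) : Prop :=
  ∃ e : Module.Basis (Fin 4) ℝ (TangentSpace (𝓡 4) p), ∃ s ∈ segreTypesVIIItoXXIII,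
    HasSegreType (endoJ (G.components p e)) s.1 s.2

/-! ### The principal matrix of the evolution equations

In what follows, `G` stands for the components `G_{abcd}` at a point with respect to a coordinate
basis `(∂_t, ∂_1, ∂_2, ∂_3)`; the index `0` is the time index, `α.succ` for `α : Fin 3` the
spatial ones. The fields are `u = (E_α, B^α)`. -/

/-- `A⁰ = diag(G^{0μ0ν}, δ^μ_ν)`. -/
def matA0 (G : Tensor4) : Matrix (Fin 3 ⊕ Fin 3) (Fin 3 ⊕ Fin 3) ℝ :=
  Matrix.fromBlocks (Matrix.of fun μ ν => invTensor G 0 μ.succ 0 ν.succ) 0 0 1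

/-- The matrices `A^α`, with upper left block `-2 G^{0(μν)α}`, upper right block
`-½ (ω_G)_{0νγδ} G^{γδμα}` and lower left block `(ω_G⁻¹)^{0μνα}`. -/
def matA (G : Tensor4) (α : Fin 3) : Matrix (Fin 3 ⊕ Fin 3) (Fin 3 ⊕ Fin 3) ℝ :=
  Matrix.fromBlocks
    (Matrix.of fun μ ν =>
      -(invTensor G 0 μ.succ ν.succ α.succ + invTensor G 0 ν.succ μ.succ α.succ))
    (Matrix.of fun μ ν => -(1 / 2 : ℝ) *
      ∑ γ, ∑ δ, volForm G 0 ν.succ γ δ * invTensor G γ δ μ.succ α.succ)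
    (Matrix.of fun μ ν => invTensor (volForm G) 0 μ.succ ν.succ α.succ)
    0

/-- The hypersurfaces `t = const` are not characteristic: `P(dt) = det A⁰ ≠ 0`. -/
def IsNoncharacteristic (G : Tensor4) : Prop := IsUnit (matA0 G).det

/-- The principal matrix `C(k) = -(A⁰)⁻¹ A^α k_α` at the spatial covector `k = k_α dx^α`. -/
def matC (G : Tensor4) (k : Fin 3 → ℝ) : Matrix (Fin 3 ⊕ Fin 3) (Fin 3 ⊕ Fin 3) ℝ :=
  -((matA0 G)⁻¹ * ∑ α, k α • matA G α)

/-- A real square matrix is diagonalizable over the complex numbers. -/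
def IsDiagonalizableOverC {n : Type*} [Fintype n] [DecidableEq n] (A : Matrix n n ℝ) : Prop :=
  ∃ (S : Matrix n n ℂ) (d : n → ℂ), IsUnit S.det ∧
    A.map Complex.ofReal = S * Matrix.diagonal d * S⁻¹

/-! ### The Cauchy problem for Maxwell's equations -/

/-- Space `ℝ³` with the coordinates `x^α`. -/
abbrev Space3 := EuclideanSpace ℝ (Fin 3)

/-- Values of the fields `(E_α, B^α)`. -/
abbrev EBField := EuclideanSpace ℝ (Fin 3 ⊕ Fin 3)

/-- The coordinate vectors `∂_t, ∂_1, ∂_2, ∂_3` of `ℝ × ℝ³`. -/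
def coordVec : Fin 4 → ℝ × Space3 :=
  Fin.cases ((1 : ℝ), 0) fun α => (0, EuclideanSpace.single α 1)

/-- The partial derivative `∂_b g` of a function on `ℝ × ℝ³`. -/
def pderiv4 (b : Fin 4) (g : ℝ × Space3 → ℝ) (z : ℝ × Space3) : ℝ := fderiv ℝ g z (coordVec b)

/-- The field strength `F_{cd}` with `E_α = F_{0α}` and `B^α = ½ (ω_G⁻¹)^{0αcd} F_{cd}`, that is
`F_{γδ} = (ω_G)_{0αγδ} B^α` for spatial `γ, δ`. -/
def fieldStrength (G : Tensor4) (v : EBField) (c d : Fin 4) : ℝ :=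
  ∑ α : Fin 3, ((if c = 0 ∧ d = α.succ then 1 else if c = α.succ ∧ d = 0 then -1 else 0) *
    v (Sum.inl α) + volForm G 0 α.succ c d * v (Sum.inr α))

/-- The left-hand side `(ω_G⁻¹)^{abcd} ∂_b F_{cd}` of the first Maxwell equation. -/
def maxwellOne (G : Tensor4) (u : ℝ × Space3 → EBField) (z : ℝ × Space3) (a : Fin 4) : ℝ :=
  ∑ b, ∑ c, ∑ d, invTensor (volForm G) a b c d * pderiv4 b (fun y => fieldStrength G (u y) c d) z

/-- The left-hand side `G^{abcd} ∂_b F_{cd}` of the second Maxwell equation, for constant `G`. -/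
def maxwellTwo (G : Tensor4) (u : ℝ × Space3 → EBField) (z : ℝ × Space3) (a : Fin 4) : ℝ :=
  ∑ b, ∑ c, ∑ d, invTensor G a b c d * pderiv4 b (fun y => fieldStrength G (u y) c d) z

/-- Classical finite-energy solutions of the Maxwell equations for the constant area metric `G`
on the slab `0 ≤ t ≤ τ`. -/
structure IsMaxwellSolution (G : Tensor4) (τ : ℝ) (u : ℝ × Space3 → EBField) : Prop where
  contDiff : ContDiff ℝ 1 u
  memLp : ∀ t ∈ Set.Icc 0 τ, MeasureTheory.MemLp (fun x => u (t, x)) 2 MeasureTheory.volume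
  eqOne : ∀ t ∈ Set.Icc 0 τ, ∀ x a, maxwellOne G u (t, x) a = 0
  eqTwo : ∀ t ∈ Set.Icc 0 τ, ∀ x a, maxwellTwo G u (t, x) a = 0

/-- The constraints on initial data: the time components `a = 0` of the Maxwell equations, which
contain no time derivative (so the datum may be extended constantly in time). -/
def SatisfiesConstraints (G : Tensor4) (f : Space3 → EBField) : Prop :=
  ∀ x, maxwellOne G (fun z => f z.2) (0, x) 0 = 0 ∧ maxwellTwo G (fun z => f z.2) (0, x) 0 = 0

/-- Well-posedness (in `L²`, locally in time) of the Cauchy problem with data on the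
noncharacteristic surface `t = 0` for Maxwell electrodynamics with constant area metric `G`:
existence for Schwartz data that satisfy the constraints, uniqueness, and continuous dependence
on the data. -/
def IsCauchyWellPosed (G : Tensor4) : Prop :=
  IsNoncharacteristic G ∧ ∃ τ : ℝ, 0 < τ ∧
    (∀ f : 𝓢(Space3, EBField), SatisfiesConstraints G f →
      ∃ u, IsMaxwellSolution G τ u ∧ ∀ x, u (0, x) = f x) ∧
    (∀ u v, IsMaxwellSolution G τ u → IsMaxwellSolution G τ v → (∀ x, u (0, x) = v (0, x)) →
      ∀ t ∈ Set.Icc 0 τ, ∀ x, u (t, x) = v (t, x)) ∧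
    ∃ K : ℝ≥0, ∀ u, IsMaxwellSolution G τ u → ∀ t ∈ Set.Icc 0 τ,
      MeasureTheory.eLpNorm (fun x => u (t, x)) 2 MeasureTheory.volume ≤
        K * MeasureTheory.eLpNorm (fun x => u (0, x)) 2 MeasureTheory.volume

/-- The Cauchy problem for Maxwell electrodynamics on `(M, G)` is well-posed at `p`: for some
time-space splitting, i.e. for some coordinates `(t, x^α)` around `p`, it is well-posed for the
coefficients frozen at `p`. These coefficients depend on the coordinates only through the
coordinate basis `(∂_t, ∂_α)` at `p`, and every basis of `T_pM` is a coordinate basis. -/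
def AreaMetric.IsMaxwellWellPosedAt {M : Type*} [TopologicalSpace M]
    [ChartedSpace (EuclideanSpace ℝ (Fin 4)) M] [IsManifold (𝓡 4) ∞ M]
    (G : AreaMetric M) (p : M) : Prop :=
  ∃ e : Module.Basis (Fin 4) ℝ (TangentSpace (𝓡 4) p), IsCauchyWellPosed (G.components p e)

end

/-! ### Two-forms on a four-dimensional space -/

/-! Let `H` be the form on two-forms given by the inverse Petrov matrix. On `e^{iq·x} F`, Maxwell's
equations say that `F` is orthogonal to `q ∧ z` for every covector `z`, with respect to both `H` and
the wedge pairing. A real Jordan block of `J` of size at least two becomes, in any frame, a chain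
`X`, `Z` of `H` relative to the pairing (`HasJordanChain.inv`,
`AreaMetric.hasJordanChain_of_frame`). A decomposable eigenvector `q ∧ r` is the amplitude of a
plane wave with wave covector `q`, and this wave has a linearly growing companion as soon as a
linear equation for one covector `r'` is solvable. By the Fredholm alternative, `NoLinearGrowth`
expresses that solvability fails for every such eigenvector (`exists_linearGrowth_of_not`).

The heart is `not_noLinearGrowth`: this failure is incompatible with a chain. The vector `X` is
orthogonal, in the pairing, to every eigenvector of `H`, hence to itself, so `X = a ∧ b`. Without
growth, a factor `a` with `H (a ∧ dt) (a ∧ dt) ≠ 0` is shared by a second decomposable eigenvector,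
with a different eigenvalue (`exists_second_eigenvector`); such factors exist because `dt` is
noncharacteristic. Iterating, and using orthogonality to `X`, one finds eigenvectors `a ∧ b`, `a ∧
c`, `c ∧ b` built on a three-dimensional space, with eigenvalues `lam`, `kap`, `mu` such that `lam ≠
kap ≠ mu`. Starting again from the factor `b + z a` gives a fourth eigenvector, with eigenvalue
other than `lam`. It must be a combination of these three, and comparing eigenvalues makes it zero.

The growing wave is a Jordan chain `u₁`, `u₂` of `C(k)` with real eigenvalue, where `k` is the
spatial part of `q` and `u₂` obeys the constraints (`exists_jordanChain`). Such a chain excludes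
diagonalizability. It also makes `exp(-2πi t C(nk)) u₂` grow linearly in `n` for fixed `t > 0`.
Smooth constrained amplitudes localized near `nk` give, by Plancherel, finite-energy solutions that
violate the stability estimate for any constant (`not_isCauchyWellPosed_of_jordanChain`). Only this
part of well-posedness is refuted. -/

/-- The wedge product of two covectors, in Petrov components. -/
def wedge : (Fin 4 → ℝ) →ₗ[ℝ] (Fin 4 → ℝ) →ₗ[ℝ] (Fin 6 → ℝ) :=
  LinearMap.mk₂ ℝ (fun a b A => a (petrovPair A).1 * b (petrovPair A).2
      - a (petrovPair A).2 * b (petrovPair A).1)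
    (fun _ _ _ => by ext A; simp; ring) (fun _ _ _ => by ext A; simp; ring)
    (fun _ _ _ => by ext A; simp; ring) (fun _ _ _ => by ext A; simp; ring)

/-- The wedge pairing of two-forms, in Petrov components. -/
def pairing : LinearMap.BilinForm ℝ (Fin 6 → ℝ) :=
  LinearMap.mk₂ ℝ (fun X Y => X 0 * Y 5 + X 5 * Y 0 + X 1 * Y 4 + X 4 * Y 1 + X 2 * Y 3 + X 3 * Y 2)
    (fun _ _ _ => by simp; ring) (fun _ _ _ => by simp; ring)
    (fun _ _ _ => by simp; ring) (fun _ _ _ => by simp; ring)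

theorem wedge_apply (a b : Fin 4 → ℝ) (A : Fin 6) : wedge a b A =
    a (petrovPair A).1 * b (petrovPair A).2 - a (petrovPair A).2 * b (petrovPair A).1 := rfl

theorem pairing_apply (X Y : Fin 6 → ℝ) : pairing X Y =
    X 0 * Y 5 + X 5 * Y 0 + X 1 * Y 4 + X 4 * Y 1 + X 2 * Y 3 + X 3 * Y 2 := rfl

@[simp] theorem wedge_self (a : Fin 4 → ℝ) : wedge a a = 0 := by
  ext A; simp [wedge_apply, mul_comm]

theorem wedge_swap (a b : Fin 4 → ℝ) : wedge a b = - wedge b a := by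
  ext A; simp [wedge_apply]; ring

theorem pairing_comm (X Y : Fin 6 → ℝ) : pairing X Y = pairing Y X := by
  simp only [pairing_apply]; ring

theorem pairing_wedge (a b c d : Fin 4 → ℝ) : pairing (wedge a b) (wedge c d) =
    (Matrix.of ![a, b, c, d]).det := by
  simp [pairing_apply, wedge_apply, petrovPair, Matrix.det_succ_row_zero, Fin.sum_univ_succ,
    Fin.succAbove]
  ring

@[simp] theorem pairing_wedge_self_left (a b c : Fin 4 → ℝ) :
    pairing (wedge a b) (wedge a c) = 0 := by
  simp [pairing_apply, wedge_apply, petrovPair]; ring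

/-- Cramer's rule with the denominator cleared: the pairing on the left is the determinant of `a, b,
c, d`. -/
theorem pairing_smul_eq (a b c d v : Fin 4 → ℝ) : pairing (wedge a b) (wedge c d) • v =
    pairing (wedge v b) (wedge c d) • a + pairing (wedge a v) (wedge c d) • b +
    pairing (wedge a b) (wedge v d) • c + pairing (wedge a b) (wedge c v) • d := by
  ext i
  fin_cases i <;> simp [pairing_apply, wedge_apply, petrovPair] <;> ring

theorem exists_relation_of_pairing_eq_zero {a b c d : Fin 4 → ℝ}
    (h : pairing (wedge a b) (wedge c d) = 0) :
    ∃ x y u v : ℝ, ¬(x = 0 ∧ y = 0 ∧ u = 0 ∧ v = 0) ∧ x • a + y • b + u • c + v • d = 0 := by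
  rw [pairing_wedge] at h
  obtain ⟨w, hw, hw0⟩ := Matrix.exists_vecMul_eq_zero_iff.mpr h
  refine ⟨w 0, w 1, w 2, w 3, ?_, ?_⟩
  · rintro ⟨h0, h1, h2, h3⟩
    exact hw (by ext i; fin_cases i <;> assumption)
  · rw [← hw0]
    ext i
    simp [Matrix.vecMul, dotProduct, Fin.sum_univ_succ]
    ring


/-- The Plücker relation. If `X ∧ X = 0`, contracting `X` with two basis vectors and wedging the
results returns `X` multiplied by its component on those two vectors. The explicit vectors below are
these contractions, so any nonzero component will do. -/
theorem exists_eq_wedge {X : Fin 6 → ℝ} (hX : pairing X X = 0) : ∃ a b, X = wedge a b := by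
  have hX' : X 0 * X 5 + X 1 * X 4 + X 2 * X 3 = 0 := by
    rw [pairing_apply] at hX; linarith
  have key : ∀ (n : Fin 6) (a b : Fin 4 → ℝ), X n ≠ 0 → (∀ A, wedge a b A = X n * X A) →
      ∃ a b, X = wedge a b := by
    intro n a b hn h
    refine ⟨(X n)⁻¹ • a, b, ?_⟩
    ext A
    simp [h A, hn]
  by_contra hcon
  have h0 : X 0 = 0 := by
    by_contra hn
    refine hcon (key 0 ![0, X 0, X 1, X 2] ![-X 0, 0, X 3, -X 4] hn fun A => ?_)
    fin_cases A <;> simp [wedge_apply, petrovPair] <;> first | ring1 | linear_combination hX' | linear_combination (-1 : ℝ) * hX'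
  have h1 : X 1 = 0 := by
    by_contra hn
    refine hcon (key 1 ![0, X 0, X 1, X 2] ![-X 1, -X 3, 0, X 5] hn fun A => ?_)
    fin_cases A <;> simp [wedge_apply, petrovPair] <;> first | ring1 | linear_combination hX' | linear_combination (-1 : ℝ) * hX'
  have h2 : X 2 = 0 := by
    by_contra hn
    refine hcon (key 2 ![0, X 0, X 1, X 2] ![-X 2, X 4, -X 5, 0] hn fun A => ?_)
    fin_cases A <;> simp [wedge_apply, petrovPair] <;> first | ring1 | linear_combination hX' | linear_combination (-1 : ℝ) * hX'
  have h3 : X 3 = 0 := by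
    by_contra hn
    refine hcon (key 3 ![-X 0, 0, X 3, -X 4] ![-X 1, -X 3, 0, X 5] hn fun A => ?_)
    fin_cases A <;> simp [wedge_apply, petrovPair] <;> first | ring1 | linear_combination hX' | linear_combination (-1 : ℝ) * hX'
  have h4 : X 4 = 0 := by
    by_contra hn
    refine hcon (key 4 ![-X 2, X 4, -X 5, 0] ![-X 0, 0, X 3, -X 4] hn fun A => ?_)
    fin_cases A <;> simp [wedge_apply, petrovPair] <;> first | ring1 | linear_combination hX' | linear_combination (-1 : ℝ) * hX'
  refine hcon ⟨![0, 0, X 5, 0], ![0, 0, 0, 1], ?_⟩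
  ext A; fin_cases A <;> simp [wedge_apply, petrovPair, *]

/-! ### Eigenvectors of a symmetric form on two-forms relative to the wedge pairing -/

/-- The form `H` on two-forms has, for the time covector `d`, no exponential polynomial
plane wave `e^{iq}(it Ω + X)` built on an eigenvector `Ω = q ∧ r`. -/
def NoLinearGrowth (H : LinearMap.BilinForm ℝ (Fin 6 → ℝ)) (d : Fin 4 → ℝ) : Prop :=
  ∀ (lam : ℝ) (q r : Fin 4 → ℝ), wedge q r ≠ 0 →
    (∀ Y, H (wedge q r) Y = lam * pairing (wedge q r) Y) →
    ∃ y, (∀ z, H (wedge q y) (wedge q z) = 0) ∧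
      H (wedge q y) (wedge d r) - lam * pairing (wedge q y) (wedge d r) ≠ 0

/-- The covectors form a basis: wedging a linear relation with `a` and testing it with `G` against
`a ∧ d` and `d ∧ b` removes the coefficients of `d` and `c`, after which `a ∧ b ≠ 0` removes the
other two. -/
theorem pairing_ne_zero_of_kernel {G : LinearMap.BilinForm ℝ (Fin 6 → ℝ)} {a b c d : Fin 4 → ℝ}
    (hab : wedge a b ≠ 0) (hG : ∀ Y, G (wedge a b) Y = 0)
    (ha : G (wedge a d) (wedge a d) ≠ 0) (hc : G (wedge a c) (wedge a d) = 0)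
    (hc' : G (wedge a c) (wedge d b) ≠ 0) : pairing (wedge a b) (wedge c d) ≠ 0 := by
  intro h
  obtain ⟨x, y, u, v, hne, hrel⟩ := exists_relation_of_pairing_eq_zero h
  have e1 : y • wedge a b + u • wedge a c + v • wedge a d = 0 := by
    have := congrArg (wedge a) hrel
    simpa using this
  have hv : v = 0 := by
    have := congrArg (fun Z => G Z (wedge a d)) e1
    simpa [hG, hc, ha] using this
  have hu : u = 0 := by
    have := congrArg (fun Z => G Z (wedge d b)) e1
    simpa [hG, hv, hc'] using this
  have hy : y = 0 := by
    simpa [hu, hv, hab] using e1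
  have hx : x = 0 := by
    have := congrArg (fun Z => wedge Z b) hrel
    simpa [hu, hv, hy, hab] using this
  exact hne ⟨hx, hy, hu, hv⟩

theorem form_eq_zero_of_wedge {f g : (Fin 6 → ℝ) →ₗ[ℝ] ℝ}
    (h : ∀ u v, f (wedge u v) = g (wedge u v)) : f = g := by
  have key : ∀ A : Fin 6, (Pi.single A 1 : Fin 6 → ℝ) =
      wedge (Pi.single (petrovPair A).1 1) (Pi.single (petrovPair A).2 1) := by
    intro A
    ext B
    fin_cases A <;> fin_cases B <;> simp [wedge_apply, petrovPair]
  refine LinearMap.pi_ext' fun A => ?_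
  ext
  simp [key A, h]

/-- An alternating form is determined by its values on a basis. -/
theorem eq_of_basis {f g : (Fin 6 → ℝ) →ₗ[ℝ] ℝ} {a b c d : Fin 4 → ℝ}
    (hD : pairing (wedge a b) (wedge c d) ≠ 0) (h1 : f (wedge a b) = g (wedge a b))
    (h2 : f (wedge a c) = g (wedge a c)) (h3 : f (wedge a d) = g (wedge a d))
    (h4 : f (wedge b c) = g (wedge b c)) (h5 : f (wedge b d) = g (wedge b d))
    (h6 : f (wedge c d) = g (wedge c d)) : f = g := by
  refine form_eq_zero_of_wedge fun u v => ?_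
  set D := pairing (wedge a b) (wedge c d)
  have : f (wedge (D • u) (D • v)) = g (wedge (D • u) (D • v)) := by
    rw [pairing_smul_eq a b c d u, pairing_smul_eq a b c d v]
    simp only [map_add, map_smul, LinearMap.add_apply, LinearMap.smul_apply, wedge_self,
      wedge_swap b a, wedge_swap c a, wedge_swap d a, wedge_swap c b, wedge_swap d b,
      wedge_swap d c, map_neg, h1, h2, h3, h4, h5, h6, smul_zero, map_zero]
  simpa [hD] using this

/-- The form `G = H - lam • pairing` annihilates `a ∧ b`, and every `q = a + z b` is also a factor
of `a ∧ b`. Absence of growth makes `G(q ∧ ·, q ∧ ·)` more degenerate than `a ∧ b` alone forces it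
to be, for all `z`. The case `z = 0` supplies `c`, and the first order in `z` shows that `G(a ∧ c,
·)` is a multiple of the pairing with some `a ∧ (c + β b)`. Since `a ∧ b` is in the kernel, the
shift by `β b` is free, and `a ∧ (c + β b)` is an eigenvector. -/
theorem exists_second_eigenvector {H : LinearMap.BilinForm ℝ (Fin 6 → ℝ)}
    (hsymm : ∀ X Y, H X Y = H Y X) {d : Fin 4 → ℝ} (hH : NoLinearGrowth H d)
    {a b : Fin 4 → ℝ} {lam : ℝ} (hab : wedge a b ≠ 0)
    (heig : ∀ Y, H (wedge a b) Y = lam * pairing (wedge a b) Y)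
    (ha : H (wedge a d) (wedge a d) ≠ 0) :
    ∃ (c : Fin 4 → ℝ) (kap : ℝ), kap ≠ lam ∧ wedge a c ≠ 0 ∧
      ∀ Y, H (wedge a c) Y = kap * pairing (wedge a c) Y := by
  obtain ⟨G, hGdef⟩ : ∃ G : LinearMap.BilinForm ℝ (Fin 6 → ℝ), G = H - lam • pairing := ⟨_, rfl⟩
  have hGH : ∀ X Y, G X Y = H X Y - lam * pairing X Y := fun X Y => by simp [hGdef]
  have hGs : ∀ X Y, G X Y = G Y X := fun X Y => by rw [hGH, hGH, hsymm, pairing_comm]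
  have hG0 : ∀ Y, G (wedge a b) Y = 0 := fun Y => by rw [hGH, heig]; ring
  have hG0' : ∀ Y, G Y (wedge a b) = 0 := fun Y => by rw [hGs, hG0]
  have hGa : G (wedge a d) (wedge a d) ≠ 0 := by rwa [hGH, pairing_wedge_self_left, mul_zero, sub_zero]
  have hker : ∀ z : ℝ, ∃ y, (∀ w, G (wedge (a + z • b) y) (wedge (a + z • b) w) = 0) ∧
      G (wedge (a + z • b) y) (wedge d b) ≠ 0 := by
    intro z
    have e : wedge (a + z • b) b = wedge a b := by simp
    obtain ⟨y, hy, hy'⟩ := hH lam (a + z • b) b (by rwa [e]) (by rwa [e])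
    refine ⟨y, fun w => ?_, ?_⟩
    · rw [hGH, hy, pairing_wedge_self_left]; ring
    · rwa [hGH]
  obtain ⟨c, hc, hc'⟩ := hker 0
  simp only [zero_smul, add_zero] at hc hc'
  have hD := pairing_ne_zero_of_kernel hab hG0 hGa (hc d) hc'
  -- The Gram determinant of `q ∧ c`, `q ∧ d` vanishes: modulo `a ∧ b`, the kernel vector `q ∧ y` is
  -- a combination of these two, and a nontrivial one because `G (q ∧ y) (d ∧ b) ≠ 0`.
  have hdet : ∀ z : ℝ, G (wedge (a + z • b) c) (wedge (a + z • b) c) *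
      G (wedge (a + z • b) d) (wedge (a + z • b) d) =
      G (wedge (a + z • b) c) (wedge (a + z • b) d) ^ 2 := by
    intro z
    obtain ⟨y, hy, hy'⟩ := hker z
    obtain ⟨q, hq⟩ : ∃ q, q = a + z • b := ⟨_, rfl⟩
    rw [← hq] at hy hy' ⊢
    obtain ⟨y1, y2, y3, y4, hyD⟩ : ∃ y1 y2 y3 y4 : ℝ, pairing (wedge a b) (wedge c d) • y =
      y1 • a + y2 • b + y3 • c + y4 • d := ⟨_, _, _, _, pairing_smul_eq a b c d y⟩
    have e0 : wedge b a = - wedge a b := wedge_swap b a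
    have e1 : pairing (wedge a b) (wedge c d) • wedge q y =
        (y2 - z * y1) • wedge a b + y3 • wedge q c + y4 • wedge q d := by
      rw [← map_smul, hyD, hq]
      simp only [map_add, map_smul, LinearMap.add_apply, LinearMap.smul_apply, wedge_self, e0]
      module
    have e2 : y3 * G (wedge q c) (wedge q c)
        + y4 * G (wedge q d) (wedge q c) = 0 := by
      have := congrArg (fun Z => G Z (wedge q c)) e1
      simp only [map_smul, map_add, LinearMap.smul_apply, LinearMap.add_apply, smul_eq_mul] at this
      rw [hy, hG0] at this
      linarith
    have e3 : y3 * G (wedge q c) (wedge q d)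
        + y4 * G (wedge q d) (wedge q d) = 0 := by
      have := congrArg (fun Z => G Z (wedge q d)) e1
      simp only [map_smul, map_add, LinearMap.smul_apply, LinearMap.add_apply, smul_eq_mul] at this
      rw [hy, hG0] at this
      linarith
    rw [hGs (wedge q d)] at e2
    by_cases h3 : y3 = 0
    · have h4 : y4 ≠ 0 := by
        rintro rfl
        apply hy'
        have := congrArg (fun Z => G Z (wedge d b)) e1
        simp only [h3, zero_smul, add_zero] at this
        simpa [-map_add, hG0, hD] using this
      rw [h3, zero_mul, zero_add, mul_eq_zero] at e2 e3
      rw [e2.resolve_left h4, e3.resolve_left h4]; ring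
    · apply mul_left_cancel₀ h3
      linear_combination G (wedge q d) (wedge q d) * e2 -
        G (wedge q c) (wedge q d) * e3
  -- As a quartic in `z`, the Gram determinant has linear coefficient `2 G(ad, ad) G(ac, bc)`. The
  -- weights on its values at `±1`, `±2` extract half of that coefficient.
  have hbc : G (wedge a c) (wedge b c) = 0 := by
    have hd1 := hdet 1
    have hd2 := hdet (-1)
    have hd3 := hdet 2
    have hd4 := hdet (-2)
    simp only [map_add, map_smul, LinearMap.add_apply, LinearMap.smul_apply, smul_eq_mul, hc,
      hGs (wedge b c) (wedge a c), hGs (wedge b d) (wedge a d)] at hd1 hd2 hd3 hd4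
    have : G (wedge a d) (wedge a d) * G (wedge a c) (wedge b c) = 0 := by
      linear_combination (1 / 3 : ℝ) * hd1 - (1 / 3 : ℝ) * hd2 - (1 / 24 : ℝ) * hd3 + (1 / 24 : ℝ) * hd4
    exact (mul_eq_zero.mp this).resolve_left hGa
  have hcb : G (wedge a c) (wedge b d) ≠ 0 := by
    rw [wedge_swap b d, map_neg]; exact neg_ne_zero.mpr hc'
  have p1 : pairing (wedge a c) (wedge b d) = - pairing (wedge a b) (wedge c d) := by
    simp only [pairing_apply, wedge_apply, petrovPair]; simp; ring
  have p2 : pairing (wedge a c) (wedge c d) = 0 := by rw [wedge_swap a c]; simp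
  have p3 : pairing (wedge a b) (wedge b d) = 0 := by rw [wedge_swap a b]; simp
  have p4 : pairing (wedge a b) (wedge b c) = 0 := by rw [wedge_swap a b]; simp
  have p5 : pairing (wedge a c) (wedge b c) = 0 := by
    rw [wedge_swap a c, wedge_swap b c]; simp
  -- On the six basis two-forms both sides can be nonzero only at `b ∧ d` and `c ∧ d`. The first
  -- fixes the scalar, the second the shift of `c` by `b`.
  have hkey : G (wedge a c) = (-G (wedge a c) (wedge b d) / pairing (wedge a b) (wedge c d)) •
      pairing (wedge a (c + (-G (wedge a c) (wedge c d) / G (wedge a c) (wedge b d)) • b)) := by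
    refine eq_of_basis hD ?_ ?_ ?_ ?_ ?_ ?_
    · simp [hG0']
    · simp [hc]
    · simp [hc]
    · simp [hbc, p4, p5]
    · simp only [LinearMap.smul_apply, map_add, map_smul, LinearMap.add_apply, p1, p3, smul_eq_mul]
      field_simp
      ring
    · simp only [LinearMap.smul_apply, map_add, map_smul, LinearMap.add_apply, p2, smul_eq_mul]
      field_simp
      ring
  refine ⟨c + (-G (wedge a c) (wedge c d) / G (wedge a c) (wedge b d)) • b, lam + -G (wedge a c) (wedge b d) / pairing (wedge a b) (wedge c d), ?_, ?_, fun Y => ?_⟩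
  rotate_left 2
  · have := LinearMap.congr_fun hkey Y
    rw [LinearMap.smul_apply, smul_eq_mul] at this
    rw [add_mul, ← this, ← sub_eq_iff_eq_add', ← hGH]
    simp [hG0]
  · simp [hcb, hD]
  · intro h0
    apply hcb
    rw [hkey, h0]
    simp

theorem eq_zero_of_pairing {X : Fin 6 → ℝ} (h : ∀ Y, pairing X Y = 0) : X = 0 := by
  ext A
  fin_cases A
  · simpa [pairing_apply] using h (Pi.single 5 1)
  · simpa [pairing_apply] using h (Pi.single 4 1)
  · simpa [pairing_apply] using h (Pi.single 3 1)
  · simpa [pairing_apply] using h (Pi.single 2 1)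
  · simpa [pairing_apply] using h (Pi.single 1 1)
  · simpa [pairing_apply] using h (Pi.single 0 1)

/-- Three independent covectors do not span the space; any covector outside their span completes
them to a basis. -/
theorem exists_pairing_ne_zero {a b c : Fin 4 → ℝ}
    (h : ∀ x y u : ℝ, x • a + y • b + u • c = 0 → x = 0 ∧ y = 0 ∧ u = 0) :
    ∃ e, pairing (wedge a b) (wedge c e) ≠ 0 := by
  have hne : Submodule.span ℝ (({a, b, c} : Finset (Fin 4 → ℝ)) : Set (Fin 4 → ℝ)) ≠ ⊤ := by
    intro htop
    have h1 := finrank_span_finset_le_card (R := ℝ) ({a, b, c} : Finset (Fin 4 → ℝ))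
    rw [Set.finrank, htop, finrank_top] at h1
    have h2 := Finset.card_le_three (a := a) (b := b) (c := c)
    simp at h1
    omega
  obtain ⟨e, -, he⟩ := SetLike.exists_of_lt (lt_top_iff_ne_top.mpr hne)
  refine ⟨e, fun h0 => ?_⟩
  obtain ⟨x, y, u, v, hxy, hrel⟩ := exists_relation_of_pairing_eq_zero h0
  have hv : v = 0 := by
    by_contra hv
    apply he
    have : e = (-v⁻¹ * x) • a + (-v⁻¹ * y) • b + (-v⁻¹ * u) • c := by
      have h3 : v • e = -(x • a + y • b + u • c) := by
        rw [← sub_eq_zero, ← hrel]; abel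
      rw [← inv_smul_smul₀ hv e, h3]
      module
    rw [this]
    refine add_mem (add_mem ?_ ?_) ?_ <;> refine Submodule.smul_mem _ _ (Submodule.subset_span ?_) <;>
      simp
  rw [hv, zero_smul, add_zero] at hrel
  obtain ⟨hx, hy, hu⟩ := h x y u hrel
  exact hxy ⟨hx, hy, hu, hv⟩

/-- A quadratic polynomial with nonzero leading coefficient has a nonzero non-root. -/
theorem exists_quadratic_ne_zero (p q : ℝ) {r : ℝ} (hr : r ≠ 0) :
    ∃ z : ℝ, z ≠ 0 ∧ p + q * z + r * z ^ 2 ≠ 0 := by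
  by_contra! h
  have h1 := h 1 one_ne_zero
  have h2 := h (-1) (by norm_num)
  have h3 := h 2 two_ne_zero
  apply hr
  linear_combination (-1 / 2 : ℝ) * h1 + (1 / 6 : ℝ) * h2 + (1 / 3 : ℝ) * h3

theorem exists_shift_ne_zero {H : LinearMap.BilinForm ℝ (Fin 6 → ℝ)} {a d : Fin 4 → ℝ}
    (ha : H (wedge a d) (wedge a d) ≠ 0) (b : Fin 4 → ℝ) :
    ∃ z : ℝ, z ≠ 0 ∧ H (wedge (b + z • a) d) (wedge (b + z • a) d) ≠ 0 := by
  obtain ⟨z, hz, h⟩ := exists_quadratic_ne_zero (H (wedge b d) (wedge b d))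
    (H (wedge b d) (wedge a d) + H (wedge a d) (wedge b d)) ha
  refine ⟨z, hz, fun h0 => h ?_⟩
  rw [← h0]
  simp only [map_add, map_smul, LinearMap.add_apply, LinearMap.smul_apply, smul_eq_mul]
  ring

theorem exists_wedge_eq {a b : Fin 4 → ℝ} {x y : ℝ} (h : ¬(x = 0 ∧ y = 0)) :
    ∃ r, wedge (x • a + y • b) r = wedge a b := by
  by_cases hx : x = 0
  · have hy : y ≠ 0 := fun hy => h ⟨hx, hy⟩
    refine ⟨(-y⁻¹) • a, ?_⟩
    rw [wedge_swap a b]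
    simp [hx, hy]
  · exact ⟨x⁻¹ • b, by simp [hx]⟩

section
variable {H : LinearMap.BilinForm ℝ (Fin 6 → ℝ)}

theorem pairing_eq_zero_of_eigenvalue_ne (hsymm : ∀ X Y, H X Y = H Y X) {X Z : Fin 6 → ℝ} {l m : ℝ}
    (hX : ∀ Y, H X Y = l * pairing X Y) (hZ : ∀ Y, H Z Y = m * pairing Z Y) (hlm : l ≠ m) :
    pairing X Z = 0 := by
  have h1 := hX Z
  rw [hsymm, hZ, pairing_comm] at h1
  have : (l - m) * pairing X Z = 0 := by linear_combination -h1
  exact (mul_eq_zero.mp this).resolve_left (sub_ne_zero.mpr hlm)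

theorem eq_zero_of_two_eigenvalues {X : Fin 6 → ℝ} {l m : ℝ}
    (hX : ∀ Y, H X Y = l * pairing X Y) (hX' : ∀ Y, H X Y = m * pairing X Y) (hlm : l ≠ m) :
    X = 0 := by
  refine eq_zero_of_pairing fun Y => ?_
  have : (l - m) * pairing X Y = 0 := by linear_combination hX' Y - hX Y
  exact (mul_eq_zero.mp this).resolve_left (sub_ne_zero.mpr hlm)

/-- Wedging a relation with `a` leaves one between eigenvectors of distinct eigenvalues, which is
trivial. -/
theorem independent_of_eigenvalue_ne {a b c : Fin 4 → ℝ} {l m : ℝ} (hab : wedge a b ≠ 0)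
    (hac : wedge a c ≠ 0) (hb : ∀ Y, H (wedge a b) Y = l * pairing (wedge a b) Y)
    (hc : ∀ Y, H (wedge a c) Y = m * pairing (wedge a c) Y) (hlm : l ≠ m) (x y u : ℝ)
    (hrel : x • a + y • b + u • c = 0) : x = 0 ∧ y = 0 ∧ u = 0 := by
  have e1 : y • wedge a b + u • wedge a c = 0 := by
    simpa using congrArg (wedge a) hrel
  have e2 : y • wedge a b = -(u • wedge a c) := eq_neg_of_add_eq_zero_left e1
  have hy : y = 0 := by
    have : y • wedge a b = 0 := by
      refine eq_zero_of_two_eigenvalues (H := H) (l := l) (m := m) (fun Y => ?_) (fun Y => ?_) hlm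
      · simp [hb]; ring
      · rw [e2]; simp [hc]; ring
    exact (smul_eq_zero.mp this).resolve_right hab
  have hu : u = 0 := by
    rw [hy, zero_smul, zero_add] at e1
    exact (smul_eq_zero.mp e1).resolve_right hac
  have ha : a ≠ 0 := by rintro rfl; simp at hab
  rw [hy, hu, zero_smul, zero_smul, add_zero, add_zero] at hrel
  exact ⟨(smul_eq_zero.mp hrel).resolve_right ha, hy, hu⟩

/-- In the plane of a decomposable eigenvector there is a covector `a` with
`H (a ∧ d) (a ∧ d) ≠ 0`, if the covector `d` is not characteristic. -/
theorem exists_nonisotropic (hsymm : ∀ X Y, H X Y = H Y X) {d : Fin 4 → ℝ}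
    (hd : ∀ w, wedge d w = 0 → ∃ s : ℝ, w = s • d)
    (hnc : ∀ y, (∀ r, H (wedge d y) (wedge d r) = 0) → wedge d y = 0)
    (hH : NoLinearGrowth H d) {a b : Fin 4 → ℝ} {lam : ℝ} (hab : wedge a b ≠ 0)
    (heig : ∀ Y, H (wedge a b) Y = lam * pairing (wedge a b) Y) :
    ∃ a' b', wedge a' b' = wedge a b ∧ H (wedge a' d) (wedge a' d) ≠ 0 := by
  -- The covector `d` is not in the plane of `a, b`. Otherwise it could serve as the factor `q` in
  -- `NoLinearGrowth`, and the kernel covector obtained there would satisfy `d ∧ v = 0` because `d`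
  -- is noncharacteristic.
  have hW : ∀ x y : ℝ, wedge d (x • a + y • b) = 0 → x = 0 ∧ y = 0 := by
    intro x y h0
    by_contra hxy
    obtain ⟨r, hr⟩ := exists_wedge_eq (a := a) (b := b) hxy
    obtain ⟨s, hs⟩ := hd _ h0
    rw [hs] at hr
    obtain ⟨v, hv, hv'⟩ := hH lam (s • d) r (by rwa [hr]) (by rwa [hr])
    have hs0 : s ≠ 0 := by rintro rfl; rw [← hr] at hab; simp at hab
    have hdv : wedge d v = 0 := by
      refine hnc v fun w => ?_
      have := hv w
      simpa [hs0] using this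
    apply hv'
    simp [hdv]
  have hind : ∀ x y u : ℝ, x • a + y • b + u • d = 0 → x = 0 ∧ y = 0 ∧ u = 0 := by
    intro x y u hrel
    obtain ⟨hx, hy⟩ := hW x y (by
      have := congrArg (wedge d) hrel
      rwa [map_add, map_smul _ u, wedge_self, smul_zero, add_zero, map_zero] at this)
    subst hx hy
    refine ⟨rfl, rfl, ?_⟩
    by_contra hu
    have hd0 : d = 0 := by simpa [hu] using hrel
    have := hW 1 0 (by simp [hd0])
    exact one_ne_zero this.1
  by_contra! hcon
  have hiso : ∀ x y : ℝ, H (wedge (x • a + y • b) d) (wedge (x • a + y • b) d) = 0 := by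
    intro x y
    by_cases hxy : x = 0 ∧ y = 0
    · simp [hxy.1, hxy.2]
    · obtain ⟨r, hr⟩ := exists_wedge_eq (a := a) (b := b) hxy
      exact hcon _ r hr
  have haa : H (wedge a d) (wedge a d) = 0 := by simpa using hiso 1 0
  have hbb : H (wedge b d) (wedge b d) = 0 := by simpa using hiso 0 1
  have hba : H (wedge a d) (wedge b d) = 0 := by
    have := hiso 1 1
    simp only [one_smul, map_add, LinearMap.add_apply, haa, hbb, hsymm (wedge b d)] at this
    linarith
  obtain ⟨c, hc⟩ := exists_pairing_ne_zero hind
  -- `H(· ∧ d, · ∧ d)` is nondegenerate on the three-dimensional quotient by `d`, so it has no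
  -- isotropic plane: a vector in the plane of `a, b` that is orthogonal to `c` would lie in the
  -- radical. A functional on that plane does have a kernel vector, which gives the contradiction.
  have hfin : ∀ x y : ℝ, H (wedge (x • a + y • b) d) (wedge c d) = 0 → x = 0 ∧ y = 0 := by
    intro x y h0
    refine hW x y (hnc _ fun v => ?_)
    have hv := pairing_smul_eq a b d c v
    have h1 : H (wedge (x • a + y • b) d) (wedge (pairing (wedge a b) (wedge d c) • v) d) = 0 := by
      rw [hv]
      simp only [map_add, map_smul, LinearMap.add_apply, LinearMap.smul_apply, smul_eq_mul] at h0 ⊢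
      rw [haa, hbb, hba, hsymm (wedge b d) (wedge a d), hba]
      simp only [wedge_self, map_zero]
      linear_combination pairing (wedge a b) (wedge d v) * h0
    rw [wedge_swap d, wedge_swap d]
    simpa [-map_add, hc] using h1
  have h1 : H (wedge a d) (wedge c d) ≠ 0 := fun h0 =>
    one_ne_zero (hfin 1 0 (by simpa using h0)).1
  refine h1 ?_
  have := (hfin (H (wedge b d) (wedge c d)) (-H (wedge a d) (wedge c d)) (by simp; ring)).2
  linarith

/-- If the form `H` has a real Jordan block of size at least two relative to the wedge pairing,
then there are plane waves with linearly growing amplitude. -/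
theorem not_noLinearGrowth (hsymm : ∀ X Y, H X Y = H Y X) {d : Fin 4 → ℝ}
    (hd : ∀ w, wedge d w = 0 → ∃ s : ℝ, w = s • d)
    (hnc : ∀ y, (∀ r, H (wedge d y) (wedge d r) = 0) → wedge d y = 0)
    {lam : ℝ} {X Z : Fin 6 → ℝ} (hX0 : X ≠ 0) (hX : ∀ Y, H X Y = lam * pairing X Y)
    (hZ : ∀ Y, H Z Y = lam * pairing Z Y + pairing X Y) : ¬ NoLinearGrowth H d := by
  intro hH
  -- For an eigenvector with the same eigenvalue, compare `H Z E` computed from the chain relation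
  -- with the value computed from `E`.
  have hXE : ∀ {m : ℝ} {E : Fin 6 → ℝ}, (∀ Y, H E Y = m * pairing E Y) → pairing X E = 0 := by
    intro m E hE
    by_cases hm : lam = m
    · have h1 := hZ E
      have h2 := hE Z
      rw [hsymm, pairing_comm, ← hm] at h2
      linarith
    · exact pairing_eq_zero_of_eigenvalue_ne hsymm hX hE hm
  obtain ⟨a₀, b₀, rfl⟩ := exists_eq_wedge (hXE hX)
  obtain ⟨a, b, hab, had⟩ := exists_nonisotropic hsymm hd hnc hH hX0 hX
  rw [← hab] at hX0 hX hZ hXE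
  clear hab a₀ b₀
  obtain ⟨c₀, kap, hkl, hac, hΘ⟩ := exists_second_eigenvector hsymm hH hX0 hX had
  obtain ⟨z, -, hcd⟩ := exists_shift_ne_zero had c₀
  obtain ⟨c, hc⟩ : ∃ c, c = c₀ + z • a := ⟨_, rfl⟩
  have hcc : wedge a c = wedge a c₀ := by simp [hc]
  rw [← hcc] at hac hΘ
  rw [← hc] at hcd
  have hca : wedge c a = - wedge a c := wedge_swap c a
  obtain ⟨y, mu, hmk, hcy, hΞ⟩ := exists_second_eigenvector hsymm hH (a := c) (b := a) (lam := kap)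
    (by rw [hca]; exact neg_ne_zero.mpr hac) (fun Y => by rw [hca]; simp [hΘ]) hcd
  have hpair := hXE hΞ
  have hind := independent_of_eigenvalue_ne hX0 hac hX hΘ hkl.symm
  -- `y` lies in the span of `a`, `b`, `c`; modify `b` so that `c ∧ b` is an eigenvector
  obtain ⟨x₁, x₂, x₃, x₄, hne, hrel⟩ := exists_relation_of_pairing_eq_zero hpair
  have hx₄ : x₄ ≠ 0 := by
    rintro rfl
    rw [zero_smul, add_zero] at hrel
    obtain ⟨h1, h2, h3⟩ := hind _ _ _ hrel
    exact hne ⟨h1, h2, h3, rfl⟩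
  have hrel' : x₁ • wedge c a + x₂ • wedge c b = - (x₄ • wedge c y) := by
    have : x₁ • wedge c a + x₂ • wedge c b + x₄ • wedge c y = 0 := by
      simpa using congrArg (wedge c) hrel
    exact eq_neg_of_add_eq_zero_left this
  have hx₂ : x₂ ≠ 0 := by
    rintro rfl
    rw [zero_smul, add_zero] at hrel'
    have : x₄ • wedge c y = 0 := by
      refine eq_zero_of_two_eigenvalues (H := H) (l := mu) (m := kap) (fun Y => ?_) (fun Y => ?_) hmk
      · simp [hΞ]; ring
      · rw [← neg_neg (x₄ • wedge c y), ← hrel', hca]; simp [hΘ]; ring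
    exact hcy ((smul_eq_zero.mp this).resolve_left hx₄)
  obtain ⟨b', hb'⟩ : ∃ b', b' = b + (x₂⁻¹ * x₁) • a := ⟨_, rfl⟩
  have hab' : wedge a b' = wedge a b := by simp [hb']
  have hcb' : wedge c b' = (-(x₂⁻¹ * x₄)) • wedge c y := by
    have : wedge c b' = x₂⁻¹ • (x₁ • wedge c a + x₂ • wedge c b) := by
      rw [hb', smul_add, inv_smul_smul₀ hx₂]; simp [mul_smul]; abel
    rw [this, hrel']; module
  have hΞ' : ∀ Y, H (wedge c b') Y = mu * pairing (wedge c b') Y := fun Y => by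
    rw [hcb']; simp [hΞ]; ring
  rw [← hab'] at hX0 hX
  clear hab' hcb' hrel' hrel hpair hXE hZ hb' hne hind hΞ hcy
  -- a third decomposable eigenvector with a factor `b' + z a`
  obtain ⟨z', hz', hbd⟩ := exists_shift_ne_zero had b'
  have e1 : wedge (b' + z' • a) a = - wedge a b' := by rw [wedge_swap a b']; simp
  obtain ⟨w, nu, hnl, hbw, hbw'⟩ := exists_second_eigenvector hsymm hH (a := b' + z' • a) (b := a)
    (lam := lam) (by rw [e1]; exact neg_ne_zero.mpr hX0) (fun Y => by rw [e1]; simp [hX]) hbd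
  have hind := independent_of_eigenvalue_ne hX0 hac hX hΘ hkl.symm
  -- The fourth eigenvector is orthogonal to at least one of `a ∧ c` and `c ∧ b'`, as their
  -- eigenvalues differ. Either orthogonality puts `w` in the span of `a, b', c`; the second one
  -- needs `z' ≠ 0`.
  have hpair : pairing (wedge a b') (wedge c w) = 0 := by
    by_cases hnk : nu = kap
    · have h1 := pairing_eq_zero_of_eigenvalue_ne hsymm hbw' hΞ' (by rw [hnk]; exact hmk.symm)
      have h2 : pairing (wedge (b' + z' • a) w) (wedge c b') =
          (-z') * pairing (wedge a b') (wedge c w) := by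
        simp [pairing_apply, wedge_apply, petrovPair]; ring
      rw [h2] at h1
      exact (mul_eq_zero.mp h1).resolve_left (neg_ne_zero.mpr hz')
    · have h1 := pairing_eq_zero_of_eigenvalue_ne hsymm hbw' hΘ hnk
      have h2 : pairing (wedge (b' + z' • a) w) (wedge a c) =
          - pairing (wedge a b') (wedge c w) := by
        simp [pairing_apply, wedge_apply, petrovPair]; ring
      rwa [h2, neg_eq_zero] at h1
  obtain ⟨y₁, y₂, y₃, y₄, hne, hrel⟩ := exists_relation_of_pairing_eq_zero hpair
  have hy₄ : y₄ ≠ 0 := by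
    rintro rfl
    rw [zero_smul, add_zero] at hrel
    obtain ⟨h1, h2, h3⟩ := hind _ _ _ hrel
    exact hne ⟨h1, h2, h3, rfl⟩
  have hrel' : (z' * y₂ - y₁) • wedge a b' - y₃ • wedge c b' + (z' * y₃) • wedge a c =
      (-y₄) • wedge (b' + z' • a) w := by
    have h1 := congrArg (wedge (b' + z' • a)) hrel
    simp only [map_add, map_smul, LinearMap.add_apply, LinearMap.smul_apply, wedge_self, map_zero,
      wedge_swap b' a, wedge_swap b' c] at h1 ⊢
    rw [← sub_eq_zero, ← h1]
    module
  obtain ⟨e, he⟩ := exists_pairing_ne_zero hind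
  -- Apply `H` to the expansion of the fourth eigenvector and subtract `nu` times the pairing. Each
  -- coefficient is then weighted by a difference of eigenvalues, and testing against `c ∧ e`, `b' ∧
  -- e`, `a ∧ e` isolates them.
  have hcoef : ∀ Y, (nu - lam) * (z' * y₂ - y₁) * pairing (wedge a b') Y
      - (nu - mu) * y₃ * pairing (wedge c b') Y
      + (nu - kap) * (z' * y₃) * pairing (wedge a c) Y = 0 := by
    intro Y
    have h1 := congrArg (fun F => H F Y) hrel'
    have h2 := congrArg (fun F => pairing F Y) hrel'
    simp only [map_add, map_sub, map_smul, LinearMap.add_apply, LinearMap.sub_apply,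
      LinearMap.smul_apply, smul_eq_mul, hX, hΞ', hΘ] at h1
    have h3 : H (wedge (b' + z' • a) w) Y = nu * pairing (wedge (b' + z' • a) w) Y := hbw' Y
    simp only [map_add, map_sub, map_smul, LinearMap.add_apply, LinearMap.sub_apply,
      LinearMap.smul_apply, smul_eq_mul] at h2 h3
    linear_combination nu * h2 - h1 + y₄ * h3
  have q1 : pairing (wedge c b') (wedge c e) = 0 := by simp
  have q2 : pairing (wedge a c) (wedge c e) = 0 := by rw [wedge_swap a c]; simp
  have q3 : pairing (wedge a b') (wedge b' e) = 0 := by rw [wedge_swap a b']; simp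
  have q4 : pairing (wedge c b') (wedge b' e) = 0 := by rw [wedge_swap c b']; simp
  have q5 : pairing (wedge a c) (wedge b' e) = - pairing (wedge a b') (wedge c e) := by
    simp [pairing_apply, wedge_apply, petrovPair]; ring
  have q6 : pairing (wedge c b') (wedge a e) = - pairing (wedge a b') (wedge c e) := by
    simp [pairing_apply, wedge_apply, petrovPair]; ring
  have r1 := hcoef (wedge c e)
  have r2 := hcoef (wedge b' e)
  have r3 := hcoef (wedge a e)
  rw [q1, q2] at r1
  rw [q3, q4, q5] at r2
  rw [pairing_wedge_self_left, pairing_wedge_self_left, q6] at r3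
  have s1 : z' * y₂ - y₁ = 0 := by
    have : ((nu - lam) * pairing (wedge a b') (wedge c e)) * (z' * y₂ - y₁) = 0 := by linarith
    exact (mul_eq_zero.mp this).resolve_left (mul_ne_zero (sub_ne_zero.mpr hnl) he)
  have s2 : (nu - kap) * y₃ = 0 := by
    have : (z' * pairing (wedge a b') (wedge c e)) * ((nu - kap) * y₃) = 0 := by
      linear_combination -r2
    exact (mul_eq_zero.mp this).resolve_left (mul_ne_zero hz' he)
  have s3 : (nu - mu) * y₃ = 0 := by
    have : pairing (wedge a b') (wedge c e) * ((nu - mu) * y₃) = 0 := by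
      linear_combination r3
    exact (mul_eq_zero.mp this).resolve_left he
  -- `y₃ ≠ 0` would force `nu = kap` and `nu = mu`.
  have hy₃ : y₃ = 0 := by
    have : (mu - kap) * y₃ = 0 := by linear_combination s2 - s3
    exact (mul_eq_zero.mp this).resolve_left (sub_ne_zero.mpr hmk)
  rw [s1, hy₃, mul_zero, zero_smul, zero_smul, zero_smul, sub_zero, add_zero] at hrel'
  exact hbw ((smul_eq_zero.mp hrel'.symm).resolve_left (neg_ne_zero.mpr hy₄))

/-- The plane wave `e^{iq}(it Ω + X)` with `Ω = q ∧ r` and `X = d ∧ r + q ∧ r'`. -/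
theorem exists_linearGrowth_of_not (hsymm : ∀ X Y, H X Y = H Y X) {d : Fin 4 → ℝ}
    (hH : ¬ NoLinearGrowth H d) : ∃ q r r' : Fin 4 → ℝ, wedge q r ≠ 0 ∧
      (∀ z, H (wedge q z) (wedge q r) = 0) ∧
      ∀ z, H (wedge q z) (wedge d r + wedge q r') + H (wedge d z) (wedge q r) = 0 := by
  simp only [NoLinearGrowth, not_forall, not_exists, not_and, not_not] at hH
  obtain ⟨lam, q, r, hqr, heig, hno⟩ := hH
  obtain ⟨T, hT⟩ : ∃ T : (Fin 4 → ℝ) →ₗ[ℝ] ((Fin 4 → ℝ) →ₗ[ℝ] ℝ),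
      ∀ y z, T y z = H (wedge q y) (wedge q z) :=
    ⟨LinearMap.compl₁₂ H (wedge q) (wedge q), fun _ _ => rfl⟩
  obtain ⟨f, hf⟩ : ∃ f : (Fin 4 → ℝ) →ₗ[ℝ] ℝ, ∀ y, f y =
      H (wedge q y) (wedge d r) - lam * pairing (wedge q y) (wedge d r) :=
    ⟨((H - lam • pairing).flip (wedge d r)).comp (wedge q), fun y => by simp⟩
  -- Fredholm alternative: a functional outside the range of the symmetric map `T` is detected by an
  -- element of the bidual, that is, by a covector `y` in the kernel of `T` with `f y ≠ 0`.
  have hmem : f ∈ LinearMap.range T := by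
    by_contra hfT
    obtain ⟨g, hg, hg0⟩ := Submodule.exists_dual_map_eq_bot_of_notMem hfT inferInstance
    obtain ⟨y, rfl⟩ := (Module.evalEquiv ℝ (Fin 4 → ℝ)).surjective g
    have hy : ∀ z, T z y = 0 := fun z => by
      have : (Module.evalEquiv ℝ (Fin 4 → ℝ)) y (T z) ∈
          (LinearMap.range T).map ((Module.evalEquiv ℝ (Fin 4 → ℝ)) y) :=
        Submodule.mem_map_of_mem ⟨z, rfl⟩
      rw [hg0] at this
      simpa using this
    apply hg
    have := hno y (fun z => by rw [hsymm, ← hT, hy])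
    simpa [hf] using this
  obtain ⟨r', hr'⟩ := hmem
  refine ⟨q, r, -r', hqr, fun z => ?_, fun z => ?_⟩
  · rw [hsymm, heig]; simp
  · have h1 := LinearMap.congr_fun hr' z
    rw [hT, hf] at h1
    rw [hsymm (wedge d z), heig]
    have e : pairing (wedge q r) (wedge d z) = pairing (wedge d r) (wedge q z) * (-1) := by
      simp [pairing_apply, wedge_apply, petrovPair]; ring
    rw [map_add, map_neg, map_neg, hsymm (wedge q z) (wedge q r'), h1, e, pairing_comm (wedge d r)]
    ring

end

noncomputable section

/-! ### The Petrov calculus -/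

/-- The Petrov matrix of the Levi-Civita symbol. -/
def petrovEps : Matrix (Fin 6) (Fin 6) ℝ :=
  Matrix.of fun A B => if (A : ℕ) + B = 5 then 1 else 0

theorem petrovEps_mulVec (X : Fin 6 → ℝ) :
    petrovEps.mulVec X = ![X 5, X 4, X 3, X 2, X 1, X 0] := by
  ext A
  fin_cases A <;> simp [petrovEps, Matrix.mulVec, dotProduct, Fin.sum_univ_succ]

theorem petrovEps_mul_self : petrovEps * petrovEps = 1 := by
  ext A B
  fin_cases A <;> fin_cases B <;> simp [petrovEps, Matrix.mul_apply, Fin.sum_univ_succ]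

theorem toBilin'_petrovEps (X Y : Fin 6 → ℝ) : Matrix.toBilin' petrovEps X Y = pairing X Y := by
  rw [Matrix.toBilin'_apply', petrovEps_mulVec, dotProduct, Fin.sum_univ_six, pairing_apply]
  simp
  ring

theorem petrovSign_eq_wedge (A : Fin 6) (a b : Fin 4) :
    petrovSign A a b = wedge (Pi.single a 1) (Pi.single b 1) A := by
  fin_cases A <;> fin_cases a <;> fin_cases b <;> simp [petrovSign, petrovPair, wedge_apply]

theorem petrovSign_pair (A B : Fin 6) :
    petrovSign A (petrovPair B).1 (petrovPair B).2 = if A = B then 1 else 0 := by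
  fin_cases A <;> fin_cases B <;> simp [petrovSign, petrovPair]

theorem unpetrov_eq (K : Matrix (Fin 6) (Fin 6) ℝ) (a b c d : Fin 4) : unpetrov K a b c d =
    Matrix.toBilin' K (wedge (Pi.single a 1) (Pi.single b 1))
      (wedge (Pi.single c 1) (Pi.single d 1)) := by
  simp only [unpetrov, petrovSign_eq_wedge, Matrix.toBilin'_apply]

theorem petrov_unpetrov (K : Matrix (Fin 6) (Fin 6) ℝ) : petrov (unpetrov K) = K := by
  ext A B
  simp [petrov, unpetrov, petrovSign_pair]

theorem leviCivita_eq : leviCivita = unpetrov petrovEps := by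
  ext a b c d
  rw [unpetrov_eq, toBilin'_petrovEps, pairing_wedge, leviCivita]
  congr 1
  ext i j
  fin_cases i <;> simp [Pi.single_apply, eq_comm]

/-- The factor `|det Petrov(G)|^{1/6}` of the volume form. -/
def volScale (G : Tensor4) : ℝ := |(petrov G).det| ^ (1 / 6 : ℝ)

theorem volForm_eq (G : Tensor4) : volForm G = unpetrov (volScale G • petrovEps) := by
  ext a b c d
  simp only [volForm, leviCivita_eq, unpetrov, volScale, Finset.mul_sum, Matrix.smul_apply, smul_eq_mul]
  refine Finset.sum_congr rfl fun A _ => Finset.sum_congr rfl fun B _ => ?_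
  ring

theorem petrov_volForm (G : Tensor4) : petrov (volForm G) = volScale G • petrovEps := by
  rw [volForm_eq, petrov_unpetrov]

theorem volScale_pos {G : Tensor4} (h : IsUnit (petrov G).det) : 0 < volScale G :=
  Real.rpow_pos_of_pos (abs_pos.mpr h.ne_zero) _

theorem inv_petrov_volForm {G : Tensor4} (h : IsUnit (petrov G).det) :
    (petrov (volForm G))⁻¹ = (volScale G)⁻¹ • petrovEps := by
  rw [petrov_volForm]
  refine Matrix.inv_eq_left_inv ?_
  rw [Matrix.smul_mul, Matrix.mul_smul, petrovEps_mul_self, smul_smul,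
    inv_mul_cancel₀ (volScale_pos h).ne', one_smul]


/-! ### The symbol of Maxwell's equations -/

/-- The Petrov components of the field strength with given fields `(E_α, B^α)`. -/
def twoForm (c : ℝ) : (Fin 3 ⊕ Fin 3 → ℝ) →ₗ[ℝ] (Fin 6 → ℝ) :=
  LinearMap.pi ![LinearMap.proj (Sum.inl 0), LinearMap.proj (Sum.inl 1), LinearMap.proj (Sum.inl 2),
    c • LinearMap.proj (Sum.inr 2), c • LinearMap.proj (Sum.inr 1), c • LinearMap.proj (Sum.inr 0)]

/-- The symbol `K^{abcd} f_{b,cd} / 2` of an equation `K^{abcd} ∂_b F_{cd} = 0`. -/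
def symb (K : Matrix (Fin 6) (Fin 6) ℝ) (f : Fin 4 → Fin 6 → ℝ) (a : Fin 4) : ℝ :=
  ∑ b, ∑ A, petrovSign A a b * (K.mulVec (f b)) A

theorem fieldStrength_eq (G : Tensor4) (v : EBField) (c d : Fin 4) :
    fieldStrength G v c d = ∑ A, twoForm (volScale G) (fun i => v i) A * petrovSign A c d := by
  rw [fieldStrength, volForm_eq]
  fin_cases c <;> fin_cases d <;>
    simp [Fin.sum_univ_succ, unpetrov, petrovSign, petrovPair, twoForm, petrovEps,
      Fin.succ_ne_zero]

theorem symb_zero (K : Matrix (Fin 6) (Fin 6) ℝ) (f : Fin 4 → Fin 6 → ℝ) : symb K f 0 =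
    K.mulVec (f 1) 0 + K.mulVec (f 2) 1 + K.mulVec (f 3) 2 := by
  simp [symb, petrovSign, petrovPair, Fin.sum_univ_succ]; ring

theorem symb_one (K : Matrix (Fin 6) (Fin 6) ℝ) (f : Fin 4 → Fin 6 → ℝ) : symb K f 1 =
    - K.mulVec (f 0) 0 + K.mulVec (f 2) 3 - K.mulVec (f 3) 4 := by
  simp [symb, petrovSign, petrovPair, Fin.sum_univ_succ]; ring

theorem symb_two (K : Matrix (Fin 6) (Fin 6) ℝ) (f : Fin 4 → Fin 6 → ℝ) : symb K f 2 =
    - K.mulVec (f 0) 1 - K.mulVec (f 1) 3 + K.mulVec (f 3) 5 := by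
  simp [symb, petrovSign, petrovPair, Fin.sum_univ_succ]; ring

theorem symb_three (K : Matrix (Fin 6) (Fin 6) ℝ) (f : Fin 4 → Fin 6 → ℝ) : symb K f 3 =
    - K.mulVec (f 0) 2 + K.mulVec (f 1) 4 - K.mulVec (f 2) 5 := by
  simp [symb, petrovSign, petrovPair, Fin.sum_univ_succ]; ring

theorem sum_mul_petrovSign (F : Fin 6 → ℝ) (B : Fin 6) :
    ∑ c, ∑ d, petrovSign B c d * ∑ A, F A * petrovSign A c d = 2 * F B := by
  fin_cases B <;> simp [petrovSign, petrovPair, Fin.sum_univ_succ] <;> ring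

theorem sum_comm_three {ι κ : Type*} [Fintype ι] [Fintype κ] (f : ι → ι → κ → ℝ) :
    ∑ c, ∑ d, ∑ A, f c d A = ∑ A, ∑ c, ∑ d, f c d A :=
  (Finset.sum_congr rfl fun _ _ => Finset.sum_comm).trans Finset.sum_comm

/-- The sum over ordered pairs `c, d` meets every Petrov index twice, whence the factor 2. -/
theorem sum_unpetrov_mul (K : Matrix (Fin 6) (Fin 6) ℝ) (F : Fin 4 → Fin 6 → ℝ) (a : Fin 4) :
    ∑ b, ∑ c, ∑ d, unpetrov K a b c d * ∑ B, F b B * petrovSign B c d = 2 * symb K F a := by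
  rw [symb, Finset.mul_sum]
  refine Finset.sum_congr rfl fun b _ => ?_
  have key : ∀ R : Fin 4 → Fin 4 → ℝ, ∑ c, ∑ d, unpetrov K a b c d * R c d =
      ∑ A, ∑ B, petrovSign A a b * K A B * ∑ c, ∑ d, petrovSign B c d * R c d := by
    intro R
    simp only [unpetrov, Finset.sum_mul, Finset.mul_sum]
    rw [sum_comm_three]
    refine Finset.sum_congr rfl fun A _ => ?_
    rw [sum_comm_three]
    simp only [mul_assoc]
  rw [key]
  simp only [sum_mul_petrovSign]
  simp only [Matrix.mulVec, dotProduct, Finset.mul_sum]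
  exact Finset.sum_congr rfl fun A _ => Finset.sum_congr rfl fun B _ => by ring

/-- Converts the component form of the equations into the coordinate-free orthogonality relations
used for two-forms. -/
theorem sum_mul_symb (K : Matrix (Fin 6) (Fin 6) ℝ) (z q : Fin 4 → ℝ) (X : Fin 6 → ℝ) :
    ∑ a, z a * symb K (fun b => q b • X) a = Matrix.toBilin' K (wedge z q) X := by
  rw [Matrix.toBilin'_apply', dotProduct, Fin.sum_univ_four, symb_zero, symb_one, symb_two,
    symb_three, Fin.sum_univ_six]
  simp only [Matrix.mulVec_smul, Pi.smul_apply, smul_eq_mul, wedge_apply, petrovPair]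
  simp
  ring

theorem symb_add (K : Matrix (Fin 6) (Fin 6) ℝ) (f g : Fin 4 → Fin 6 → ℝ) (a : Fin 4) :
    symb K (fun b => f b + g b) a = symb K f a + symb K g a := by
  simp only [symb, Matrix.mulVec_add, Pi.add_apply, mul_add, Finset.sum_add_distrib]

/-- The symbol `A⁰ v₀ + A^α v_α` of the evolution equations. -/
def evolutionSymbol (G : Tensor4) (v : Fin 4 → Fin 3 ⊕ Fin 3 → ℝ) : Fin 3 ⊕ Fin 3 → ℝ :=
  (matA0 G).mulVec (v 0) + ∑ α : Fin 3, (matA G α).mulVec (v α.succ)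

theorem evolutionSymbol_inr {G : Tensor4} (h : IsUnit (petrov G).det)
    (v : Fin 4 → Fin 3 ⊕ Fin 3 → ℝ) (μ : Fin 3) : evolutionSymbol G v (Sum.inr μ) =
      - symb ((volScale G)⁻¹ • petrovEps) (fun b => twoForm (volScale G) (v b)) μ.succ := by
  have hc := (volScale_pos h).ne'
  have hi : invTensor (volForm G) = unpetrov ((volScale G)⁻¹ • petrovEps) := by
    rw [invTensor, inv_petrov_volForm h]
  obtain rfl | rfl | rfl : μ = 0 ∨ μ = 1 ∨ μ = 2 := by omega
  · rw [show (0 : Fin 3).succ = 1 from rfl, symb_one]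
    simp only [Matrix.smul_mulVec, petrovEps_mulVec]
    simp [twoForm, evolutionSymbol, matA0, matA, Matrix.mulVec, dotProduct, Fin.sum_univ_succ, hi,
      unpetrov, petrovSign, petrovPair, petrovEps, hc, Matrix.one_apply]
    ring
  · rw [show (1 : Fin 3).succ = 2 from rfl, symb_two]
    simp only [Matrix.smul_mulVec, petrovEps_mulVec]
    simp [twoForm, evolutionSymbol, matA0, matA, Matrix.mulVec, dotProduct, Fin.sum_univ_succ, hi,
      unpetrov, petrovSign, petrovPair, petrovEps, hc, Matrix.one_apply]
    ring
  · rw [show (2 : Fin 3).succ = 3 from rfl, symb_three]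
    simp only [Matrix.smul_mulVec, petrovEps_mulVec]
    simp [twoForm, evolutionSymbol, matA0, matA, Matrix.mulVec, dotProduct, Fin.sum_univ_succ, hi,
      unpetrov, petrovSign, petrovPair, petrovEps, hc, Matrix.one_apply]
    ring

-- The spatial components of the second Maxwell equation contain `∂_t B`. Adding multiples of the
-- `B` rows trades it for spatial derivatives of `E`, which is the origin of the symmetrization in
-- the upper left block of `A^α`. The multipliers are entries of the inverse Petrov matrix between
-- `[0μ]` and the spatial pair complementary to `[0α]`, whose Petrov index is the reversal of that
-- of `[0α]`.
set_option linter.unusedSimpArgs false in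
set_option maxHeartbeats 1000000 in
theorem evolutionSymbol_inl {G : Tensor4} (h : IsUnit (petrov G).det)
    (hs : (petrov G).IsSymm) (v : Fin 4 → Fin 3 ⊕ Fin 3 → ℝ) (μ : Fin 3) :
    evolutionSymbol G v (Sum.inl μ) =
      - symb ((petrov G)⁻¹) (fun b => twoForm (volScale G) (v b)) μ.succ
      + ∑ α : Fin 3, (-volScale G * (petrov G)⁻¹ ((μ.castLE (by omega)) : Fin 6)
          (α.castLE (by omega) : Fin 6).rev) * evolutionSymbol G v (Sum.inr α) := by
  have hc := (volScale_pos h).ne'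
  have hi : invTensor (volForm G) = unpetrov ((volScale G)⁻¹ • petrovEps) := by
    rw [invTensor, inv_petrov_volForm h]
  have hv := volForm_eq G
  obtain ⟨K, hKdef⟩ : ∃ K, K = (petrov G)⁻¹ := ⟨_, rfl⟩
  have hK : invTensor G = unpetrov K := by rw [invTensor, hKdef]
  have hKs : ∀ i j, K i j = K j i := fun i j => by
    have := hs.inv
    rw [← hKdef] at this
    exact this.apply j i
  rw [← hKdef]
  clear hKdef hs h
  have h10 := hKs 1 0
  have h20 := hKs 2 0
  have h21 := hKs 2 1
  have h30 := hKs 3 0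
  have h31 := hKs 3 1
  have h32 := hKs 3 2
  have h40 := hKs 4 0
  have h41 := hKs 4 1
  have h42 := hKs 4 2
  have h43 := hKs 4 3
  have h50 := hKs 5 0
  have h51 := hKs 5 1
  have h52 := hKs 5 2
  have h53 := hKs 5 3
  have h54 := hKs 5 4
  clear hKs
  have r0 : (Fin.castLE (by omega) (0 : Fin 3) : Fin 6) = 0 := rfl
  have r1 : (Fin.castLE (by omega) (1 : Fin 3) : Fin 6) = 1 := rfl
  have r2 : (Fin.castLE (by omega) (2 : Fin 3) : Fin 6) = 2 := rfl
  have s0 : (Fin.rev 0 : Fin 6) = 5 := rfl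
  have s1 : (Fin.rev 1 : Fin 6) = 4 := rfl
  have s2 : (Fin.rev 2 : Fin 6) = 3 := rfl
  rw [Fin.sum_univ_three, r0, r1, r2, s0, s1, s2]
  obtain rfl | rfl | rfl : μ = 0 ∨ μ = 1 ∨ μ = 2 := by omega
  · rw [show (0 : Fin 3).succ = 1 from rfl, symb_one]
    rw [r0]
    simp only [evolutionSymbol, matA0, matA, hi, hK]
    simp [twoForm, Matrix.mulVec, dotProduct, Fin.sum_univ_succ, hv, unpetrov, petrovSign,
      petrovPair, petrovEps, Matrix.one_apply]
    simp only [h10, h20, h30, h40, h50, h21, h31, h41, h51, h32, h42, h52, h43, h53, h54]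
    field_simp
    ring
  · rw [show (1 : Fin 3).succ = 2 from rfl, symb_two]
    rw [r1]
    simp only [evolutionSymbol, matA0, matA, hi, hK]
    simp [twoForm, Matrix.mulVec, dotProduct, Fin.sum_univ_succ, hv, unpetrov, petrovSign,
      petrovPair, petrovEps, Matrix.one_apply]
    simp only [h10, h20, h30, h40, h50, h21, h31, h41, h51, h32, h42, h52, h43, h53, h54]
    field_simp
    ring
  · rw [show (2 : Fin 3).succ = 3 from rfl, symb_three]
    rw [r2]
    simp only [evolutionSymbol, matA0, matA, hi, hK]
    simp [twoForm, Matrix.mulVec, dotProduct, Fin.sum_univ_succ, hv, unpetrov, petrovSign,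
      petrovPair, petrovEps, Matrix.one_apply]
    simp only [h10, h20, h30, h40, h50, h21, h31, h41, h51, h32, h42, h52, h43, h53, h54]
    field_simp
    ring

end

/-! ### Constraints and Jordan chains of the principal matrix -/

noncomputable section

/-- The symbols of both Maxwell equations vanish at the derivatives `f b` of the fields. -/
def MaxwellSymbolVanishes (G : Tensor4) (f : Fin 4 → Fin 3 ⊕ Fin 3 → ℝ) : Prop :=
  ∀ a, symb ((volScale G)⁻¹ • petrovEps) (fun b => twoForm (volScale G) (f b)) a = 0 ∧
    symb ((petrov G)⁻¹) (fun b => twoForm (volScale G) (f b)) a = 0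

/-- The evolution rows are a triangular recombination of the spatial Maxwell equations, so the two
systems are equivalent. The components `a = 0` are left over as the constraints. -/
theorem evolutionSymbol_eq_zero_iff {G : Tensor4} (h : IsUnit (petrov G).det)
    (hs : (petrov G).IsSymm) (v : Fin 4 → Fin 3 ⊕ Fin 3 → ℝ) : evolutionSymbol G v = 0 ↔
    ∀ μ : Fin 3,
      symb ((volScale G)⁻¹ • petrovEps) (fun b => twoForm (volScale G) (v b)) μ.succ = 0 ∧
      symb ((petrov G)⁻¹) (fun b => twoForm (volScale G) (v b)) μ.succ = 0 := by
  constructor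
  · intro h0 μ
    have h1 := evolutionSymbol_inr h v μ
    have h2 := evolutionSymbol_inl h hs v μ
    simp only [h0, Pi.zero_apply, mul_zero, Finset.sum_const_zero, add_zero] at h1 h2
    constructor <;> linarith
  · intro h0
    have h1 : ∀ μ, evolutionSymbol G v (Sum.inr μ) = 0 := fun μ => by
      rw [evolutionSymbol_inr h, (h0 μ).1, neg_zero]
    ext i
    rcases i with μ | μ
    · rw [evolutionSymbol_inl h hs, (h0 μ).2]
      simp [h1]
    · exact h1 μ

theorem matC_mulVec_eq_iff {G : Tensor4} (hn : IsNoncharacteristic G) (k : Fin 3 → ℝ)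
    (b v₀ : Fin 3 ⊕ Fin 3 → ℝ) : (matC G k).mulVec b = v₀ ↔
      evolutionSymbol G (Fin.cons v₀ fun α => k α • b) = 0 := by
  have e : evolutionSymbol G (Fin.cons v₀ fun α => k α • b) =
      (matA0 G).mulVec (v₀ - (matC G k).mulVec b) := by
    simp only [evolutionSymbol, Fin.cons_zero, Fin.cons_succ, matC,
      Matrix.neg_mulVec, sub_neg_eq_add, ← Matrix.mulVec_mulVec]
    rw [Matrix.mulVec_add, Matrix.mulVec_mulVec _ (matA0 G), Matrix.mul_nonsing_inv _ hn, Matrix.one_mulVec,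
      Matrix.sum_mulVec]
    simp [Matrix.mulVec_smul, Matrix.smul_mulVec]
  rw [e]
  constructor
  · rintro rfl; simp
  · intro h0
    have h1 := congrArg ((matA0 G)⁻¹).mulVec h0
    rw [Matrix.mulVec_mulVec, Matrix.nonsing_inv_mul _ hn, Matrix.one_mulVec, Matrix.mulVec_zero,
      sub_eq_zero] at h1
    exact h1.symm

/-- The time covector `dt`. -/
def timeCovector : Fin 4 → ℝ := Pi.single 0 1

/-- The two-form `dt ∧ k` for a spatial covector `k`. -/
def timeWedge : (Fin 3 → ℝ) →ₗ[ℝ] (Fin 6 → ℝ) :=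
  LinearMap.pi ![LinearMap.proj 0, LinearMap.proj 1, LinearMap.proj 2, 0, 0, 0]

theorem wedge_timeCovector (y : Fin 4 → ℝ) :
    wedge timeCovector y = timeWedge fun α => y α.succ := by
  ext A
  fin_cases A <;> simp [wedge_apply, petrovPair, timeWedge, timeCovector]

/-- The Fourier transformed constraints on the fields `b` at the spatial covector `k`. -/
def IsConstrained (G : Tensor4) (k : Fin 3 → ℝ) (b : Fin 3 ⊕ Fin 3 → ℝ) : Prop :=
  pairing (timeWedge k) (twoForm (volScale G) b) = 0 ∧
    Matrix.toBilin' (petrov G)⁻¹ (timeWedge k) (twoForm (volScale G) b) = 0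

theorem symb_zero_eq (K : Matrix (Fin 6) (Fin 6) ℝ) (k : Fin 3 → ℝ) (X : Fin 6 → ℝ)
    {f : Fin 4 → Fin 6 → ℝ} (hf : ∀ α : Fin 3, f α.succ = k α • X) :
    symb K f 0 = Matrix.toBilin' K (timeWedge k) X := by
  rw [symb_zero, show f 1 = _ from hf 0, show f 2 = _ from hf 1, show f 3 = _ from hf 2,
    Matrix.toBilin'_apply', dotProduct, Fin.sum_univ_six]
  simp [timeWedge, Matrix.mulVec_smul]

theorem toBilin'_smul_petrovEps (c : ℝ) (X Y : Fin 6 → ℝ) :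
    Matrix.toBilin' (c • petrovEps) X Y = c * pairing X Y := by
  rw [map_smul, LinearMap.smul_apply, LinearMap.smul_apply, toBilin'_petrovEps, smul_eq_mul]

/-- Contraction of the symbol with the wave covector eliminates the spatial derivatives. -/
theorem sum_mul_symb_succ (K : Matrix (Fin 6) (Fin 6) ℝ) (k : Fin 3 → ℝ) (X : Fin 6 → ℝ)
    {f : Fin 4 → Fin 6 → ℝ} (hf : ∀ α : Fin 3, f α.succ = k α • X) :
    ∑ α : Fin 3, k α * symb K f α.succ = - Matrix.toBilin' K (timeWedge k) (f 0) := by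
  rw [Fin.sum_univ_three, show (0 : Fin 3).succ = 1 from rfl, show (1 : Fin 3).succ = 2 from rfl,
    show (2 : Fin 3).succ = 3 from rfl, symb_one, symb_two, symb_three,
    show f 1 = _ from hf 0, show f 2 = _ from hf 1, show f 3 = _ from hf 2,
    Matrix.toBilin'_apply', dotProduct, Fin.sum_univ_six]
  simp only [timeWedge, Matrix.mulVec_smul, Pi.smul_apply, smul_eq_mul]
  simp
  ring


/-- Contracting the spatial equations with `k` removes the spatial derivatives by antisymmetry. What
remains is the constraints applied to the time derivative `C(k) b`. This is why the evolution
preserves them. -/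
theorem isConstrained_matC_mulVec {G : Tensor4} (h : IsUnit (petrov G).det) (hs : (petrov G).IsSymm)
    (hn : IsNoncharacteristic G) (k : Fin 3 → ℝ) (b : Fin 3 ⊕ Fin 3 → ℝ) :
    IsConstrained G k ((matC G k).mulVec b) := by
  have h0 := (evolutionSymbol_eq_zero_iff h hs _).mp ((matC_mulVec_eq_iff hn k b _).mp rfl)
  have hf : ∀ α : Fin 3, twoForm (volScale G)
      ((Fin.cons ((matC G k).mulVec b) fun α => k α • b : Fin 4 → Fin 3 ⊕ Fin 3 → ℝ) α.succ) =
      k α • twoForm (volScale G) b := fun α => by simp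
  have h1 := sum_mul_symb_succ ((volScale G)⁻¹ • petrovEps) k _
    (f := fun b => twoForm (volScale G) (_ : Fin 3 ⊕ Fin 3 → ℝ)) hf
  have h2 := sum_mul_symb_succ (petrov G)⁻¹ k _
    (f := fun b => twoForm (volScale G) (_ : Fin 3 ⊕ Fin 3 → ℝ)) hf
  simp only [(h0 _).1, (h0 _).2, mul_zero, Finset.sum_const_zero, Fin.cons_zero,
    toBilin'_smul_petrovEps] at h1 h2
  have hc := inv_ne_zero (volScale_pos h).ne'
  refine ⟨?_, by linarith⟩
  have : (volScale G)⁻¹ * pairing (timeWedge k) (twoForm (volScale G) ((matC G k).mulVec b)) = 0 := by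
    linarith
  exact (mul_eq_zero.mp this).resolve_left hc

theorem maxwellSymbolVanishes_of_isConstrained {G : Tensor4} (h : IsUnit (petrov G).det) (hs : (petrov G).IsSymm)
    (hn : IsNoncharacteristic G) {k : Fin 3 → ℝ} {b : Fin 3 ⊕ Fin 3 → ℝ}
    (hb : IsConstrained G k b) :
    MaxwellSymbolVanishes G (Fin.cons ((matC G k).mulVec b) fun α => k α • b) := by
  have h0 := (evolutionSymbol_eq_zero_iff h hs _).mp ((matC_mulVec_eq_iff hn k b _).mp rfl)
  have hf : ∀ α : Fin 3, twoForm (volScale G)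
      ((Fin.cons ((matC G k).mulVec b) fun α => k α • b : Fin 4 → Fin 3 ⊕ Fin 3 → ℝ) α.succ) =
      k α • twoForm (volScale G) b := fun α => by simp
  intro a
  induction a using Fin.cases with
  | zero =>
    rw [symb_zero_eq _ k _ (f := fun b => twoForm (volScale G) (_ : Fin 3 ⊕ Fin 3 → ℝ)) hf,
      symb_zero_eq _ k _ (f := fun b => twoForm (volScale G) (_ : Fin 3 ⊕ Fin 3 → ℝ)) hf,
      toBilin'_smul_petrovEps, hb.1, hb.2, mul_zero]
    exact ⟨rfl, rfl⟩
  | succ μ => exact h0 μ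

theorem matC_mulVec_of_maxwellSymbolVanishes {G : Tensor4} (h : IsUnit (petrov G).det) (hs : (petrov G).IsSymm)
    (hn : IsNoncharacteristic G) {k : Fin 3 → ℝ} {b v₀ : Fin 3 ⊕ Fin 3 → ℝ}
    (hv : MaxwellSymbolVanishes G (Fin.cons v₀ fun α => k α • b)) :
    (matC G k).mulVec b = v₀ ∧ IsConstrained G k b := by
  have hf : ∀ α : Fin 3, twoForm (volScale G)
      ((Fin.cons v₀ fun α => k α • b : Fin 4 → Fin 3 ⊕ Fin 3 → ℝ) α.succ) =
      k α • twoForm (volScale G) b := fun α => by simp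
  refine ⟨(matC_mulVec_eq_iff hn k b _).mpr
    ((evolutionSymbol_eq_zero_iff h hs _).mpr fun μ => hv μ.succ), ?_⟩
  have h0 := hv 0
  rw [symb_zero_eq _ k _ (f := fun b => twoForm (volScale G) (_ : Fin 3 ⊕ Fin 3 → ℝ)) hf,
    symb_zero_eq _ k _ (f := fun b => twoForm (volScale G) (_ : Fin 3 ⊕ Fin 3 → ℝ)) hf,
    toBilin'_smul_petrovEps] at h0
  exact ⟨(mul_eq_zero.mp h0.1).resolve_left (inv_ne_zero (volScale_pos h).ne'), h0.2⟩

theorem exists_twoForm_eq {c : ℝ} (hc : c ≠ 0) (X : Fin 6 → ℝ) : ∃ u, twoForm c u = X := by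
  refine ⟨Sum.elim ![X 0, X 1, X 2] ![c⁻¹ * X 5, c⁻¹ * X 4, c⁻¹ * X 3], ?_⟩
  ext A
  fin_cases A <;> simp [twoForm, hc]


theorem matA0_mulVec (G : Tensor4) (b : Fin 3 ⊕ Fin 3 → ℝ) : (matA0 G).mulVec b =
    Sum.elim (fun μ => Matrix.toBilin' (petrov G)⁻¹ (timeWedge (Pi.single μ 1))
      (timeWedge fun α => b (Sum.inl α))) fun μ => b (Sum.inr μ) := by
  have e : ∀ μ ν : Fin 3, invTensor G 0 μ.succ 0 ν.succ = Matrix.toBilin' (petrov G)⁻¹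
      (timeWedge (Pi.single μ 1)) (timeWedge (Pi.single ν 1)) := by
    intro μ ν
    have e' : ∀ μ : Fin 3, wedge (Pi.single 0 1) (Pi.single μ.succ 1) =
        timeWedge (Pi.single μ 1) := by
      intro μ
      change wedge timeCovector _ = _
      rw [wedge_timeCovector]
      congr 1
      ext α
      simp [Pi.single_apply]
    rw [invTensor, unpetrov_eq, e', e']
  have e2 : (timeWedge fun α => b (Sum.inl α)) =
      ∑ ν, b (Sum.inl ν) • timeWedge (Pi.single ν 1) := by
    simp_rw [← map_smul, ← map_sum]
    congr 1
    ext α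
    simp [Finset.sum_apply, Pi.single_apply]
  ext i
  rcases i with μ | μ
  · simp only [matA0, Matrix.mulVec, dotProduct, Fintype.sum_sum_type, Matrix.fromBlocks_apply₁₁,
      Matrix.fromBlocks_apply₁₂, Matrix.of_apply, e, e2, map_sum, map_smul]
    simp [mul_comm]
  · simp [matA0, Matrix.mulVec, dotProduct, Matrix.one_apply]

theorem toBilin'_symm {n : Type*} [Fintype n] [DecidableEq n] {K : Matrix n n ℝ} (hK : K.IsSymm)
    (X Y : n → ℝ) : Matrix.toBilin' K X Y = Matrix.toBilin' K Y X := by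
  rw [Matrix.toBilin'_apply', Matrix.toBilin'_apply', Matrix.dotProduct_mulVec,
    ← Matrix.mulVec_transpose, hK.eq, dotProduct_comm]

theorem timeWedge_eq_sum (k : Fin 3 → ℝ) :
    timeWedge k = ∑ μ, k μ • timeWedge (Pi.single μ 1) := by
  simp_rw [← map_smul, ← map_sum]
  congr 1
  ext α
  simp [Finset.sum_apply, Pi.single_apply]

/-- The upper left block of `A⁰` is the Gram matrix of the two-forms `dt ∧ dx^μ`, so invertibility
of `A⁰` is nondegeneracy of the form on `dt ∧ ·`. -/
theorem eq_zero_of_noncharacteristic {G : Tensor4} (hs : (petrov G).IsSymm)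
    (hn : IsNoncharacteristic G) {y : Fin 3 → ℝ}
    (hy : ∀ r, Matrix.toBilin' (petrov G)⁻¹ (timeWedge y) (timeWedge r) = 0) : y = 0 := by
  have h0 : (matA0 G).mulVec (Sum.elim y 0) = 0 := by
    rw [matA0_mulVec]
    ext i
    rcases i with μ | μ
    · have := hy (Pi.single μ 1)
      rw [toBilin'_symm hs.inv] at this
      simpa using this
    · simp
  have h1 := congrArg ((matA0 G)⁻¹).mulVec h0
  rw [Matrix.mulVec_mulVec, Matrix.nonsing_inv_mul _ hn, Matrix.one_mulVec, Matrix.mulVec_zero] at h1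
  ext α
  exact congrFun h1 (Sum.inl α)

/-- A constrained amplitude extends to a smooth field of constrained amplitudes. -/
theorem exists_constrained_extension {G : Tensor4} (h : IsUnit (petrov G).det)
    (hn : IsNoncharacteristic G)
    {k₀ : Fin 3 → ℝ} (hk₀ : k₀ ≠ 0) {b : Fin 3 ⊕ Fin 3 → ℝ} (hb : IsConstrained G k₀ b) :
    ∃ g : (Fin 3 → ℝ) → Fin 3 ⊕ Fin 3 → ℝ, ContDiff ℝ ∞ g ∧ (∀ k, IsConstrained G k (g k)) ∧
      ∃ ρ : ℝ, ρ ≠ 0 ∧ g k₀ = ρ • b := by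
  have hc := (volScale_pos h).ne'
  set c := volScale G
  set K := (petrov G)⁻¹
  have hb₁ : pairing (timeWedge k₀) (twoForm c b) = 0 := hb.1
  have hb₂ : Matrix.toBilin' K (timeWedge k₀) (twoForm c b) = 0 := hb.2
  -- Correction fields: `eB k` is purely magnetic and shifts the first constraint by `c |k|²`. The
  -- field `eE k` is purely electric, leaves the first constraint alone, and shifts the second by
  -- `|k|²`.
  obtain ⟨eB, heB⟩ : ∃ eB : (Fin 3 → ℝ) →ₗ[ℝ] Fin 3 ⊕ Fin 3 → ℝ, ∀ k, eB k = Sum.elim (0 : Fin 3 → ℝ) k :=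
    ⟨LinearMap.pi (Sum.elim (0 : Fin 3 → (Fin 3 → ℝ) →ₗ[ℝ] ℝ) fun α => LinearMap.proj α), fun k => by
      ext i; rcases i with i | i <;> simp⟩
  obtain ⟨eE, heE⟩ : ∃ eE : (Fin 3 → ℝ) →ₗ[ℝ] Fin 3 ⊕ Fin 3 → ℝ, ∀ k,
      (matA0 G).mulVec (eE k) = Sum.elim k 0 := by
    refine ⟨((matA0 G)⁻¹).mulVecLin.comp
      (LinearMap.pi (Sum.elim (fun α => LinearMap.proj α) (0 : Fin 3 → (Fin 3 → ℝ) →ₗ[ℝ] ℝ))), fun k => ?_⟩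
    rw [LinearMap.comp_apply, Matrix.mulVecLin_apply, Matrix.mulVec_mulVec,
      Matrix.mul_nonsing_inv _ hn, Matrix.one_mulVec]
    ext i; rcases i with i | i <;> simp
  have hB : ∀ k, pairing (timeWedge k) (twoForm c (eB k)) = c * ∑ α, k α ^ 2 := fun k => by
    simp [heB, pairing_apply, timeWedge, twoForm, Fin.sum_univ_three]; ring
  have heEr : ∀ k μ, eE k (Sum.inr μ) = 0 := fun k μ => by
    have := congrFun (heE k) (Sum.inr μ)
    rw [matA0_mulVec] at this
    simpa using this
  have htE : ∀ k, twoForm c (eE k) = timeWedge fun α => eE k (Sum.inl α) := fun k => by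
    ext A
    fin_cases A <;> simp [twoForm, timeWedge, heEr]
  have hE : ∀ k, pairing (timeWedge k) (twoForm c (eE k)) = 0 := fun k => by
    rw [htE]; simp [pairing_apply, timeWedge]
  have hE' : ∀ k, Matrix.toBilin' K (timeWedge k) (twoForm c (eE k)) = ∑ α, k α ^ 2 := fun k => by
    rw [htE, timeWedge_eq_sum k]
    simp only [map_sum, map_smul, LinearMap.sum_apply, LinearMap.smul_apply, smul_eq_mul]
    refine Finset.sum_congr rfl fun μ _ => ?_
    have := congrFun (heE k) (Sum.inl μ)
    rw [matA0_mulVec] at this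
    simp only [Sum.elim_inl] at this
    rw [this]; ring
  -- Multiplying by `|k|²` instead of dividing keeps the projections polynomial in `k`, hence smooth
  -- at `k = 0`; the price is the scalar `ρ = c |k₀|⁴`.
  obtain ⟨g₁, hg₁⟩ : ∃ g₁ : (Fin 3 → ℝ) → Fin 3 ⊕ Fin 3 → ℝ, ∀ k, g₁ k =
      (c * ∑ α, k α ^ 2) • b - pairing (timeWedge k) (twoForm c b) • eB k := ⟨_, fun _ => rfl⟩
  have seB : ContDiff ℝ ∞ eB := (LinearMap.toContinuousLinearMap eB).contDiff
  have seE : ContDiff ℝ ∞ eE := (LinearMap.toContinuousLinearMap eE).contDiff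
  have stW : ContDiff ℝ ∞ timeWedge := (LinearMap.toContinuousLinearMap timeWedge).contDiff
  have stF : ContDiff ℝ ∞ (twoForm c) := (LinearMap.toContinuousLinearMap (twoForm c)).contDiff
  have stWi : ∀ A, ContDiff ℝ ∞ fun k => timeWedge k A := contDiff_pi.mp stW
  have sq : ContDiff ℝ ∞ fun k : Fin 3 → ℝ => ∑ α, k α ^ 2 := by fun_prop
  have sg₁ : ContDiff ℝ ∞ g₁ := by
    rw [show g₁ = _ from funext hg₁]
    simp only [pairing_apply]
    fun_prop
  have sg₁i : ∀ A, ContDiff ℝ ∞ fun k => twoForm c (g₁ k) A := contDiff_pi.mp (stF.comp sg₁)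
  refine ⟨fun k => (∑ α, k α ^ 2) • g₁ k - Matrix.toBilin' K (timeWedge k) (twoForm c (g₁ k)) • eE k,
    ?_, fun k => ⟨?_, ?_⟩, c * (∑ α, k₀ α ^ 2) * ∑ α, k₀ α ^ 2, ?_, ?_⟩
  · simp only [Matrix.toBilin'_apply]
    fun_prop
  · change pairing (timeWedge k) (twoForm c _) = 0
    simp only [map_sub, map_smul, hE, hg₁, hB, smul_eq_mul]
    ring
  · change Matrix.toBilin' K (timeWedge k) (twoForm c _) = 0
    simp only [map_sub, map_smul, hE', smul_eq_mul]
    ring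
  · have : (∑ α, k₀ α ^ 2) ≠ 0 := by
      intro h0
      rw [Finset.sum_eq_zero_iff_of_nonneg (fun _ _ => sq_nonneg _)] at h0
      exact hk₀ (funext fun α => by simpa using h0 α (Finset.mem_univ α))
    positivity
  · have e1 : g₁ k₀ = (c * ∑ α, k₀ α ^ 2) • b := by rw [hg₁, hb₁, zero_smul, sub_zero]
    simp only [e1, map_smul, hb₂, smul_zero, zero_smul, sub_zero, smul_smul]
    congr 1
    ring

/-- With `d = dt`, this is the part of the equation for `e^{iq·x}(it Ω + X)` that is free of `t`. -/
theorem symb_eq_zero_of_form {K : Matrix (Fin 6) (Fin 6) ℝ} {q d : Fin 4 → ℝ} {X Ω : Fin 6 → ℝ}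
    (hform : ∀ z, Matrix.toBilin' K (wedge q z) X + Matrix.toBilin' K (wedge d z) Ω = 0)
    (a : Fin 4) : symb K (fun b => q b • X + d b • Ω) a = 0 := by
  have h1 := sum_mul_symb K (Pi.single a 1) q X
  have h2 := sum_mul_symb K (Pi.single a 1) d Ω
  have h3 := hform (Pi.single a 1)
  rw [wedge_swap q, wedge_swap d, map_neg, map_neg, LinearMap.neg_apply, LinearMap.neg_apply,
    ← h1, ← h2] at h3
  rw [symb_add]
  simp [Pi.single_apply] at h3
  linarith

/-- A real Jordan block of size two yields a Jordan chain of `C(k)` for some spatial covector `k`,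
consisting of constrained amplitudes. -/
theorem exists_jordanChain {G : Tensor4} (h : IsUnit (petrov G).det) (hs : (petrov G).IsSymm)
    (hn : IsNoncharacteristic G) {lam : ℝ} {X Z : Fin 6 → ℝ} (hX0 : X ≠ 0)
    (hX : ∀ Y, Matrix.toBilin' (petrov G)⁻¹ X Y = lam * pairing X Y)
    (hZ : ∀ Y, Matrix.toBilin' (petrov G)⁻¹ Z Y = lam * pairing Z Y + pairing X Y) :
    ∃ (k : Fin 3 → ℝ) (s : ℝ) (u₁ u₂ : Fin 3 ⊕ Fin 3 → ℝ), u₁ ≠ 0 ∧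
      (matC G k).mulVec u₁ = s • u₁ ∧ (matC G k).mulVec u₂ = s • u₂ + u₁ ∧
      IsConstrained G k u₂ := by
  have hc := (volScale_pos h).ne'
  have hd : ∀ w, wedge timeCovector w = 0 → ∃ s : ℝ, w = s • timeCovector := by
    intro w hw
    refine ⟨w 0, ?_⟩
    have h1 := congrFun hw 0
    have h2 := congrFun hw 1
    have h3 := congrFun hw 2
    simp [wedge_apply, petrovPair, timeCovector] at h1 h2 h3
    ext i
    fin_cases i <;> simp [timeCovector, h1, h2, h3]
  have hnc : ∀ y, (∀ r, Matrix.toBilin' (petrov G)⁻¹ (wedge timeCovector y)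
      (wedge timeCovector r) = 0) → wedge timeCovector y = 0 := by
    intro y hy
    have h0 : (fun α : Fin 3 => y α.succ) = 0 := by
      refine eq_zero_of_noncharacteristic hs hn fun r => ?_
      have := hy (Fin.cons 0 r)
      simpa only [wedge_timeCovector, Fin.cons_succ] using this
    rw [wedge_timeCovector, h0, map_zero]
  obtain ⟨q, r, r', hqr, h1, h2⟩ := exists_linearGrowth_of_not (toBilin'_symm hs.inv)
    (not_noLinearGrowth (toBilin'_symm hs.inv) hd hnc hX0 hX hZ)
  obtain ⟨u₁, hu₁⟩ := exists_twoForm_eq hc (wedge q r)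
  obtain ⟨u₂, hu₂⟩ := exists_twoForm_eq hc (wedge timeCovector r + wedge q r')
  have hv₁ : MaxwellSymbolVanishes G (Fin.cons (q 0 • u₁) fun α => q α.succ • u₁) := by
    have e : (fun b => twoForm (volScale G)
        ((Fin.cons (q 0 • u₁) fun α => q α.succ • u₁ : Fin 4 → Fin 3 ⊕ Fin 3 → ℝ) b)) =
        fun b => q b • wedge q r + (0 : Fin 4 → ℝ) b • wedge q r := by
      ext1 b
      induction b using Fin.cases <;> simp [hu₁]
    intro a
    rw [e]
    refine ⟨symb_eq_zero_of_form (fun z => ?_) a, symb_eq_zero_of_form (fun z => ?_) a⟩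
    · rw [toBilin'_smul_petrovEps]; simp
    · simp [h1]
  have hv₂ : MaxwellSymbolVanishes G (Fin.cons (q 0 • u₂ + u₁) fun α => q α.succ • u₂) := by
    have e : (fun b => twoForm (volScale G)
        ((Fin.cons (q 0 • u₂ + u₁) fun α => q α.succ • u₂ : Fin 4 → Fin 3 ⊕ Fin 3 → ℝ) b)) =
        fun b => q b • (wedge timeCovector r + wedge q r') + timeCovector b • wedge q r := by
      ext1 b
      induction b using Fin.cases <;> simp [hu₁, hu₂, timeCovector]
    intro a
    rw [e]
    refine ⟨symb_eq_zero_of_form (fun z => ?_) a, symb_eq_zero_of_form h2 a⟩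
    -- The first Maxwell equation holds for any `r'`: `q ∧ dt ∧ r` and `dt ∧ q ∧ r` cancel.
    have e' : pairing (wedge timeCovector z) (wedge q r) =
        - pairing (wedge q z) (wedge timeCovector r) := by
      simp [pairing_apply, wedge_apply, petrovPair]; ring
    rw [toBilin'_smul_petrovEps, toBilin'_smul_petrovEps, e', map_add, pairing_wedge_self_left]
    ring
  obtain ⟨m₁, -⟩ := matC_mulVec_of_maxwellSymbolVanishes h hs hn (k := fun α => q α.succ) hv₁
  obtain ⟨m₂, c₂⟩ := matC_mulVec_of_maxwellSymbolVanishes h hs hn (k := fun α => q α.succ) hv₂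
  refine ⟨fun α => q α.succ, q 0, u₁, u₂, ?_, m₁, m₂, c₂⟩
  rintro rfl
  rw [map_zero] at hu₁
  exact hqr hu₁.symm

/-- In diagonalizing coordinates the chain relations read `d w₁ = s w₁` and `d w₂ = s w₂ + w₁` in
each component; eliminating `d` gives `w₁² = 0`. -/
theorem not_isDiagonalizableOverC_of_jordanChain {n : Type*} [Fintype n] [DecidableEq n]
    {A : Matrix n n ℝ} {s : ℝ} {u₁ u₂ : n → ℝ} (hu : u₁ ≠ 0) (h₁ : A.mulVec u₁ = s • u₁)
    (h₂ : A.mulVec u₂ = s • u₂ + u₁) : ¬ IsDiagonalizableOverC A := by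
  rintro ⟨S, d, hS, hA⟩
  have hmap : ∀ v : n → ℝ, (A.map Complex.ofReal).mulVec (fun i => (v i : ℂ)) =
      fun i => ((A.mulVec v i : ℝ) : ℂ) := fun v => by
    ext i; simp [Matrix.mulVec, dotProduct]
  have hw : ∀ v : n → ℝ, ∀ i, (S⁻¹.mulVec fun i => ((A.mulVec v i : ℝ) : ℂ)) i =
      d i * (S⁻¹.mulVec fun i => (v i : ℂ)) i := fun v i => by
    rw [← hmap, hA, Matrix.mulVec_mulVec, ← mul_assoc, ← mul_assoc, Matrix.nonsing_inv_mul _ hS,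
      one_mul, ← Matrix.mulVec_mulVec, Matrix.mulVec_diagonal]
  have e₁ : (fun i => ((A.mulVec u₁ i : ℝ) : ℂ)) = (s : ℂ) • fun i => (u₁ i : ℂ) := by
    ext i; simp [h₁]
  have e₂ : (fun i => ((A.mulVec u₂ i : ℝ) : ℂ)) =
      (s : ℂ) • (fun i => (u₂ i : ℂ)) + fun i => (u₁ i : ℂ) := by
    ext i; simp [h₂]
  have hz : S⁻¹.mulVec (fun i => (u₁ i : ℂ)) = 0 := by
    ext i
    have a₁ := hw u₁ i
    have a₂ := hw u₂ i
    rw [e₁, Matrix.mulVec_smul, Pi.smul_apply, smul_eq_mul] at a₁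
    rw [e₂, Matrix.mulVec_add, Matrix.mulVec_smul, Pi.add_apply, Pi.smul_apply, smul_eq_mul] at a₂
    set w₁ := S⁻¹.mulVec (fun i => (u₁ i : ℂ)) i
    set w₂ := S⁻¹.mulVec (fun i => (u₂ i : ℂ)) i
    have : w₁ * w₁ = 0 := by linear_combination (-w₂) * a₁ + w₁ * a₂
    exact mul_self_eq_zero.mp this
  have h0 := congrArg S.mulVec hz
  rw [Matrix.mulVec_mulVec, Matrix.mul_nonsing_inv _ hS, Matrix.one_mulVec, Matrix.mulVec_zero] at h0
  apply hu
  ext i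
  simpa using congrFun h0 i

end

noncomputable section

/-! ### From the Segré type to a Jordan chain -/

theorem map_ofReal_mulVec {n : Type*} [Fintype n] (J : Matrix n n ℝ) (v : n → ℂ) (i : n) :
    ((J.map Complex.ofReal).mulVec v i).re = J.mulVec (fun j => (v j).re) i ∧
    ((J.map Complex.ofReal).mulVec v i).im = J.mulVec (fun j => (v j).im) i := by
  simp [Matrix.mulVec, dotProduct]

/-- As `J` and `m` are real, real and imaginary parts of a chain are again chains, and one of them
has a nonzero first vector. -/
theorem exists_real_jordanChain_of_complex {n : Type*} [Fintype n] {J : Matrix n n ℝ} {m : ℝ}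
    {v w : n → ℂ} (hv0 : v ≠ 0) (hv : (J.map Complex.ofReal).mulVec v = (m : ℂ) • v)
    (hw : (J.map Complex.ofReal).mulVec w = (m : ℂ) • w + v) :
    ∃ x z : n → ℝ, x ≠ 0 ∧ J.mulVec x = m • x ∧ J.mulVec z = m • z + x := by
  by_cases h0 : (fun j => (v j).re) = 0
  · refine ⟨fun j => (v j).im, fun j => (w j).im, fun h1 => hv0 ?_, ?_, ?_⟩
    · ext j
      exact Complex.ext (congrFun h0 j) (congrFun h1 j)
    · ext i; rw [← (map_ofReal_mulVec J v i).2, hv]; simp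
    · ext i; rw [← (map_ofReal_mulVec J w i).2, hw]; simp
  · refine ⟨fun j => (v j).re, fun j => (w j).re, h0, ?_, ?_⟩
    · ext i; rw [← (map_ofReal_mulVec J v i).1, hv]; simp
    · ext i; rw [← (map_ofReal_mulVec J w i).1, hw]; simp

/-- The columns of `P` belonging to the first two positions of the block form the chain, because the
ones of `jordanBlock` are on the superdiagonal. -/
theorem HasSegreType.exists_jordanChain {J : Matrix (Fin 6) (Fin 6) ℝ} {r c : List ℕ}
    (hJ : HasSegreType J r c) (hr : ∃ i : Fin r.length, 2 ≤ r.get i) :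
    ∃ (m : ℝ) (x z : Fin 6 → ℝ), x ≠ 0 ∧ J.mulVec x = m • x ∧ J.mulVec z = m • z + x := by
  obtain ⟨i, hi⟩ := hr
  obtain ⟨lam, mu, -, P, Q, -, hQP, hJ⟩ := hJ
  have hsize : segreSize r c (Sum.inl i) = r.get i := rfl
  have hpos0 : 0 < segreSize r c (Sum.inl i) := by omega
  have hpos1 : 1 < segreSize r c (Sum.inl i) := by omega
  set p0 : Σ i, Fin (segreSize r c i) := ⟨Sum.inl i, ⟨0, hpos0⟩⟩ with hp0
  set p1 : Σ i, Fin (segreSize r c i) := ⟨Sum.inl i, ⟨1, hpos1⟩⟩ with hp1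
  set B := Matrix.blockDiagonal' (fun i => jordanBlock (segreSize r c i) (segreEigenvalue r c lam mu i))
  have hB : ∀ e, (J.map Complex.ofReal).mulVec (P.mulVec e) = P.mulVec (B.mulVec e) := fun e => by
    rw [hJ, Matrix.mulVec_mulVec, Matrix.mul_assoc, hQP, Matrix.mul_one, ← Matrix.mulVec_mulVec]
  have hBeq : ∀ l l', B ⟨Sum.inl i, l⟩ ⟨Sum.inl i, l'⟩ = jordanBlock (segreSize r c (Sum.inl i))
      (segreEigenvalue r c lam mu (Sum.inl i)) l l' := fun l l' =>
    Matrix.blockDiagonal'_apply_eq _ _ _ _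
  have hBne : ∀ j l l', j ≠ Sum.inl i → B ⟨j, l⟩ ⟨Sum.inl i, l'⟩ = 0 := fun j l l' hj =>
    Matrix.blockDiagonal'_apply_ne _ _ _ hj
  have hB0 : B.mulVec (Pi.single p0 1) = (lam i : ℂ) • Pi.single p0 1 := by
    ext ⟨j, l⟩
    rw [Matrix.mulVec_single_one, Matrix.col_apply, Pi.smul_apply]
    by_cases hj : j = Sum.inl i
    · subst hj
      rw [hp0, hBeq]
      by_cases hl : l = ⟨0, hpos0⟩
      · subst hl; simp [jordanBlock, segreEigenvalue]
      · simp [jordanBlock, hl]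
    · have : (⟨j, l⟩ : Σ i, Fin (segreSize r c i)) ≠ p0 := by
        rintro h; exact hj (congrArg Sigma.fst h)
      rw [hp0, hBne _ _ _ hj, ← hp0, Pi.single_eq_of_ne this, smul_zero]
  have hB1 : B.mulVec (Pi.single p1 1) = (lam i : ℂ) • Pi.single p1 1 + Pi.single p0 1 := by
    ext ⟨j, l⟩
    rw [Matrix.mulVec_single_one, Matrix.col_apply, Pi.add_apply, Pi.smul_apply]
    by_cases hj : j = Sum.inl i
    · subst hj
      rw [hp1, hBeq]
      by_cases hl : l = ⟨1, hpos1⟩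
      · subst hl
        have : (⟨Sum.inl i, ⟨1, hpos1⟩⟩ : Σ i, Fin (segreSize r c i)) ≠ p0 := by
          simp [hp0]
        simp [jordanBlock, segreEigenvalue, Pi.single_eq_of_ne this]
      · by_cases hl0 : l = ⟨0, hpos0⟩
        · subst hl0
          simp [jordanBlock, hp0]
        · have h0 : (⟨Sum.inl i, l⟩ : Σ i, Fin (segreSize r c i)) ≠ p0 := by
            simpa [hp0] using hl0
          have h2 : (l : ℕ) ≠ 0 := fun h => hl0 (Fin.ext h)
          simp [jordanBlock, hl, h2, Pi.single_eq_of_ne h0]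
    · have h1 : (⟨j, l⟩ : Σ i, Fin (segreSize r c i)) ≠ p1 := by
        rintro h; exact hj (congrArg Sigma.fst h)
      have h0 : (⟨j, l⟩ : Σ i, Fin (segreSize r c i)) ≠ p0 := by
        rintro h; exact hj (congrArg Sigma.fst h)
      rw [hp1, hBne _ _ _ hj, ← hp1, Pi.single_eq_of_ne h1,
        Pi.single_eq_of_ne h0, smul_zero, add_zero]
  refine ⟨lam i, exists_real_jordanChain_of_complex (v := P.mulVec (Pi.single p0 1))
    (w := P.mulVec (Pi.single p1 1)) ?_ ?_ ?_⟩
  · intro h0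
    have := congrArg Q.mulVec h0
    rw [Matrix.mulVec_mulVec, hQP, Matrix.one_mulVec, Matrix.mulVec_zero] at this
    simpa using congrFun this p0
  · rw [hB, hB0, Matrix.mulVec_smul]
  · rw [hB, hB1, Matrix.mulVec_add, Matrix.mulVec_smul]

theorem exists_two_le_of_mem_segreTypes :
    ∀ s ∈ segreTypesVIIItoXXIII, ∃ i : Fin s.1.length, 2 ≤ s.1.get i := by
  decide

/-- The form `S` has, relative to the wedge pairing, a real Jordan block of size at least two. -/
def HasJordanChain (S : LinearMap.BilinForm ℝ (Fin 6 → ℝ)) : Prop :=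
  ∃ (lam : ℝ) (X Z : Fin 6 → ℝ), X ≠ 0 ∧ (∀ Y, S X Y = lam * pairing X Y) ∧
    ∀ Y, S Z Y = lam * pairing Z Y + pairing X Y

theorem hasJordanChain_of_mulVec {S : Matrix (Fin 6) (Fin 6) ℝ} (hS : S.IsSymm) {lam ρ : ℝ}
    (hρ : ρ ≠ 0) {X Z : Fin 6 → ℝ} (hX0 : X ≠ 0)
    (hX : S.mulVec X = lam • petrovEps.mulVec X)
    (hZ : S.mulVec Z = lam • petrovEps.mulVec Z + ρ • petrovEps.mulVec X) :
    HasJordanChain (Matrix.toBilin' S) := by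
  have e : ∀ X Y, Matrix.toBilin' S X Y = Y ⬝ᵥ S.mulVec X := fun X Y => by
    rw [toBilin'_symm hS, Matrix.toBilin'_apply']
  have e' : ∀ X Y, pairing X Y = Y ⬝ᵥ petrovEps.mulVec X := fun X Y => by
    rw [pairing_comm, ← toBilin'_petrovEps, Matrix.toBilin'_apply']
  refine ⟨lam, ρ • X, Z, smul_ne_zero hρ hX0, fun Y => ?_, fun Y => ?_⟩
  · simp only [map_smul, LinearMap.smul_apply, e, hX, e', dotProduct_smul, smul_eq_mul]
    ring
  · simp only [map_smul, LinearMap.smul_apply, e, hZ, e', dotProduct_add, dotProduct_smul,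
      smul_eq_mul]

/-- With `ε` the matrix of the pairing, `S X = lam ε X` turns into `S⁻¹ (ε X) = lam⁻¹ ε (ε X)`
because `ε² = 1`. So `ε X`, `ε Z` is a chain for the inverse, up to the factor `-lam⁻²` in the
off-diagonal term. -/
theorem HasJordanChain.inv {S : Matrix (Fin 6) (Fin 6) ℝ} (hS : S.IsSymm) (hu : IsUnit S.det)
    (hJ : HasJordanChain (Matrix.toBilin' S)) : HasJordanChain (Matrix.toBilin' S⁻¹) := by
  obtain ⟨lam, X, Z, hX0, hX, hZ⟩ := hJ
  have e : ∀ X Y, Matrix.toBilin' S X Y = S.mulVec X ⬝ᵥ Y := fun X Y => by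
    rw [toBilin'_symm hS, Matrix.toBilin'_apply', dotProduct_comm]
  have e' : ∀ X Y, pairing X Y = petrovEps.mulVec X ⬝ᵥ Y := fun X Y => by
    rw [pairing_comm, ← toBilin'_petrovEps, Matrix.toBilin'_apply', dotProduct_comm]
  have hX' : S.mulVec X = lam • petrovEps.mulVec X := by
    refine dotProduct_eq _ _ fun Y => ?_
    rw [← e, hX, e', smul_dotProduct, smul_eq_mul]
  have hZ' : S.mulVec Z = lam • petrovEps.mulVec Z + petrovEps.mulVec X := by
    refine dotProduct_eq _ _ fun Y => ?_
    rw [← e, hZ, add_dotProduct, ← e', smul_dotProduct, smul_eq_mul, ← e']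
  have hinv : ∀ V, (S⁻¹).mulVec (S.mulVec V) = V := fun V => by
    rw [Matrix.mulVec_mulVec, Matrix.nonsing_inv_mul _ hu, Matrix.one_mulVec]
  have hlam : lam ≠ 0 := by
    rintro rfl
    rw [zero_smul] at hX'
    apply hX0
    rw [← hinv X, hX', Matrix.mulVec_zero]
  have hee : ∀ V, petrovEps.mulVec (petrovEps.mulVec V) = V := fun V => by
    rw [Matrix.mulVec_mulVec, petrovEps_mul_self, Matrix.one_mulVec]
  have k₁ : (S⁻¹).mulVec (petrovEps.mulVec X) = lam⁻¹ • X := by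
    have := hinv X
    rw [hX', Matrix.mulVec_smul] at this
    rw [← inv_smul_smul₀ hlam ((S⁻¹).mulVec _), this]
  have k₂ : (S⁻¹).mulVec (petrovEps.mulVec Z) = lam⁻¹ • Z + (-lam⁻¹ * lam⁻¹) • X := by
    have := hinv Z
    rw [hZ', Matrix.mulVec_add, Matrix.mulVec_smul, k₁] at this
    rw [← inv_smul_smul₀ hlam ((S⁻¹).mulVec (petrovEps.mulVec Z)), ← sub_eq_of_eq_add this.symm]
    module
  refine hasJordanChain_of_mulVec hS.inv (lam := lam⁻¹) (ρ := -lam⁻¹ * lam⁻¹)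
    (X := petrovEps.mulVec X) (Z := petrovEps.mulVec Z) ?_ ?_ ?_ ?_
  · simp [hlam]
  · intro h0
    apply hX0
    rw [← hee X, h0, Matrix.mulVec_zero]
  · rw [k₁, hee]
  · rw [k₂, hee, hee]

/-- `J` is the Petrov matrix composed with the inverse pairing, up to the volume factor, so
eigenvectors of `J` are eigenvectors of the form relative to the pairing. -/
theorem hasJordanChain_of_endoJ {G : Tensor4} (h : IsUnit (petrov G).det) (hs : (petrov G).IsSymm)
    {m : ℝ} {x z : Fin 6 → ℝ} (hx : x ≠ 0) (h₁ : (endoJ G).mulVec x = m • x)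
    (h₂ : (endoJ G).mulVec z = m • z + x) : HasJordanChain (Matrix.toBilin' (petrov G)) := by
  have hc := (volScale_pos h).ne'
  have e : ∀ v, (petrov G).mulVec v = volScale G • petrovEps.mulVec ((endoJ G).mulVec v) := by
    intro v
    rw [endoJ, inv_petrov_volForm h, Matrix.smul_mul, Matrix.smul_mulVec, Matrix.mulVec_smul,
      smul_smul, mul_inv_cancel₀ hc, one_smul, Matrix.mulVec_mulVec, ← mul_assoc,
      petrovEps_mul_self, one_mul]
  refine hasJordanChain_of_mulVec hs (lam := volScale G * m) (Z := z) hc hx ?_ ?_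
  · rw [e, h₁, Matrix.mulVec_smul, smul_smul]
  · rw [e, h₂, Matrix.mulVec_add, Matrix.mulVec_smul, smul_add, smul_smul]

/-! ### Change of frame -/

theorem antisymm_apply_eq_sum {V : Type*} [AddCommGroup V] [Module ℝ V]
    (f : V →ₗ[ℝ] V →ₗ[ℝ] ℝ) (hf : ∀ x y, f x y = - f y x) (e : Module.Basis (Fin 4) ℝ V) (x y : V) :
    f x y = ∑ A, wedge (e.repr x) (e.repr y) A * f (e (petrovPair A).1) (e (petrovPair A).2) := by
  have h0 : ∀ x, f x x = 0 := fun x => by linarith [hf x x]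
  conv_lhs => rw [← e.sum_repr x, ← e.sum_repr y]
  simp only [Fin.sum_univ_four, map_add, map_smul, LinearMap.add_apply, LinearMap.smul_apply,
    smul_eq_mul, h0, Fin.sum_univ_six, wedge_apply, petrovPair]
  simp
  linear_combination (e.repr x 1 * e.repr y 0) * hf (e 1) (e 0)
    + (e.repr x 2 * e.repr y 0) * hf (e 2) (e 0) + (e.repr x 3 * e.repr y 0) * hf (e 3) (e 0)
    + (e.repr x 2 * e.repr y 1) * hf (e 2) (e 1) + (e.repr x 1 * e.repr y 3) * hf (e 1) (e 3)
    + (e.repr x 3 * e.repr y 2) * hf (e 3) (e 2)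

section
variable {M : Type*} [TopologicalSpace M] [ChartedSpace (EuclideanSpace ℝ (Fin 4)) M]
  [IsManifold (𝓡 4) ∞ M]

theorem AreaMetric.apply_eq (G : AreaMetric M) (p : M)
    (e : Module.Basis (Fin 4) ℝ (TangentSpace (𝓡 4) p)) (x y z w : TangentSpace (𝓡 4) p) :
    G.toFun p x y z w = Matrix.toBilin' (petrov (G.components p e))
      (wedge (e.repr x) (e.repr y)) (wedge (e.repr z) (e.repr w)) := by
  have anti : ∀ x y z w, G.toFun p z w x y = - G.toFun p z w y x := fun x y z w => by
    rw [G.symm, G.antisymm, G.symm]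
  rw [antisymm_apply_eq_sum (G.toFun p x y) (fun a b => anti a b x y) e z w,
    Matrix.toBilin'_apply, Finset.sum_comm]
  refine Finset.sum_congr rfl fun B _ => ?_
  rw [G.symm, antisymm_apply_eq_sum (G.toFun p _ _) (fun a b => anti a b _ _) e x y, Finset.mul_sum]
  refine Finset.sum_congr rfl fun A _ => ?_
  rw [G.symm]
  simp only [petrov, Matrix.of_apply, AreaMetric.components]
  ring

theorem AreaMetric.isSymm_petrov (G : AreaMetric M) (p : M)
    (e : Module.Basis (Fin 4) ℝ (TangentSpace (𝓡 4) p)) : (petrov (G.components p e)).IsSymm := by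
  ext A B
  exact G.symm p _ _ _ _

/-- The map induced on bivectors by a change of frame. -/
def bivectorMap (l : Fin 4 → Fin 4 → ℝ) : (Fin 6 → ℝ) →ₗ[ℝ] (Fin 6 → ℝ) :=
  ∑ A, (LinearMap.proj A : (Fin 6 → ℝ) →ₗ[ℝ] ℝ).smulRight
    (wedge (l (petrovPair A).1) (l (petrovPair A).2))

theorem bivectorMap_apply (l : Fin 4 → Fin 4 → ℝ) (X : Fin 6 → ℝ) : bivectorMap l X =
    ∑ A, X A • wedge (l (petrovPair A).1) (l (petrovPair A).2) := by
  simp [bivectorMap]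

theorem pairing_bivectorMap (l : Fin 4 → Fin 4 → ℝ) (X Y : Fin 6 → ℝ) :
    pairing (bivectorMap l X) (bivectorMap l Y) =
      pairing (wedge (l 0) (l 1)) (wedge (l 2) (l 3)) * pairing X Y := by
  simp only [bivectorMap_apply, map_sum, map_smul, LinearMap.sum_apply, LinearMap.smul_apply,
    smul_eq_mul]
  have key : ∀ A B, pairing (wedge (l (petrovPair A).1) (l (petrovPair A).2))
      (wedge (l (petrovPair B).1) (l (petrovPair B).2)) =
      pairing (wedge (l 0) (l 1)) (wedge (l 2) (l 3)) * petrovEps A B := by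
    intro A B
    fin_cases A <;> fin_cases B <;> simp [petrovPair, petrovEps] <;>
      simp [pairing_apply, wedge_apply, petrovPair] <;> ring
  simp only [key]
  rw [← toBilin'_petrovEps X Y, Matrix.toBilin'_apply, Finset.sum_comm]
  simp only [Finset.mul_sum]
  exact Finset.sum_congr rfl fun A _ => Finset.sum_congr rfl fun B _ => by ring

theorem AreaMetric.toBilin'_petrov_components (G : AreaMetric M) (p : M)
    (e e' : Module.Basis (Fin 4) ℝ (TangentSpace (𝓡 4) p)) (X Y : Fin 6 → ℝ) :
    Matrix.toBilin' (petrov (G.components p e')) X Y =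
      Matrix.toBilin' (petrov (G.components p e)) (bivectorMap (fun a => e.repr (e' a)) X)
        (bivectorMap (fun a => e.repr (e' a)) Y) := by
  simp only [bivectorMap_apply, map_sum, map_smul, LinearMap.sum_apply, LinearMap.smul_apply,
    smul_eq_mul, ← AreaMetric.apply_eq]
  rw [Matrix.toBilin'_apply, Finset.sum_comm]
  simp only [Finset.mul_sum]
  refine Finset.sum_congr rfl fun A _ => Finset.sum_congr rfl fun B _ => ?_
  simp only [petrov, Matrix.of_apply, AreaMetric.components]
  ring

/-- The induced map on bivectors carries one form to the other and multiplies the pairing by the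
determinant `D` of the frame change. The chain survives with eigenvalue `lam * D`, after rescaling
its first vector by `D`. -/
theorem AreaMetric.hasJordanChain_of_frame (G : AreaMetric M) (p : M)
    (e e' : Module.Basis (Fin 4) ℝ (TangentSpace (𝓡 4) p))
    (hJ : HasJordanChain (Matrix.toBilin' (petrov (G.components p e)))) :
    HasJordanChain (Matrix.toBilin' (petrov (G.components p e'))) := by
  obtain ⟨lam, X, Z, hX0, hX, hZ⟩ := hJ
  set l : Fin 4 → Fin 4 → ℝ := fun a => e.repr (e' a) with hl
  set D := pairing (wedge (l 0) (l 1)) (wedge (l 2) (l 3)) with hDdef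
  have hD : D ≠ 0 := by
    intro h0
    obtain ⟨x, y, u, v, hne, hrel⟩ := exists_relation_of_pairing_eq_zero h0
    have hrel' : e.repr (x • e' 0 + y • e' 1 + u • e' 2 + v • e' 3) = 0 := by
      ext i
      simpa [hl] using congrFun hrel i
    have h1 : x • e' 0 + y • e' 1 + u • e' 2 + v • e' 3 = 0 := by
      exact e.repr.map_eq_zero_iff.mp hrel'
    have h2 := Fintype.linearIndependent_iff.mp e'.linearIndependent ![x, y, u, v]
      (by simpa [Fin.sum_univ_four] using h1)
    exact hne ⟨h2 0, h2 1, h2 2, h2 3⟩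
  have hinj : Function.Injective (bivectorMap l) := by
    rw [injective_iff_map_eq_zero]
    intro V hV
    refine eq_zero_of_pairing fun Y => ?_
    have := pairing_bivectorMap l V Y
    rw [hV, map_zero, LinearMap.zero_apply] at this
    exact (mul_eq_zero.mp this.symm).resolve_left hD
  have hsurj := LinearMap.injective_iff_surjective.mp hinj
  obtain ⟨X', rfl⟩ := hsurj X
  obtain ⟨Z', rfl⟩ := hsurj Z
  refine ⟨lam * D, D • X', Z', smul_ne_zero hD ?_, fun Y => ?_, fun Y => ?_⟩
  · rintro rfl; simp at hX0
  · rw [map_smul, map_smul, LinearMap.smul_apply, LinearMap.smul_apply, smul_eq_mul, smul_eq_mul,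
      G.toBilin'_petrov_components p e e', hX, pairing_bivectorMap]
    ring
  · rw [map_smul, LinearMap.smul_apply, smul_eq_mul,
      G.toBilin'_petrov_components p e e', hZ, pairing_bivectorMap, pairing_bivectorMap]
    ring

/-- At a point of metaclass VIII to XXIII, for every noncharacteristic splitting, some `C(k)` has
a Jordan chain of constrained amplitudes. -/
theorem AreaMetric.exists_jordanChain (G : AreaMetric M) (p : M) (hp : G.IsMetaclassVIIItoXXIIIAt p)
    (e : Module.Basis (Fin 4) ℝ (TangentSpace (𝓡 4) p))
    (hn : IsNoncharacteristic (G.components p e)) :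
    ∃ (k : Fin 3 → ℝ) (s : ℝ) (u₁ u₂ : Fin 3 ⊕ Fin 3 → ℝ), u₁ ≠ 0 ∧
      (matC (G.components p e) k).mulVec u₁ = s • u₁ ∧
      (matC (G.components p e) k).mulVec u₂ = s • u₂ + u₁ ∧
      IsConstrained (G.components p e) k u₂ := by
  obtain ⟨e₀, s, hs, hJ⟩ := hp
  obtain ⟨m, x, z, hx, h₁, h₂⟩ := hJ.exists_jordanChain (exists_two_le_of_mem_segreTypes s hs)
  have hu : ∀ e, IsUnit (petrov (G.components p e)).det := G.invertible p
  have hc := ((G.hasJordanChain_of_frame p e₀ e) (hasJordanChain_of_endoJ (hu e₀)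
    (G.isSymm_petrov p e₀) hx h₁ h₂)).inv (G.isSymm_petrov p e) (hu e)
  obtain ⟨lam, X, Z, hX0, hX, hZ⟩ := hc
  exact _root_.exists_jordanChain (hu e) (G.isSymm_petrov p e) hn hX0 hX hZ

end

end

noncomputable section

/-! ### Differentiation of parametric integrals -/

section ParametricIntegral

open MeasureTheory

variable {Z V F : Type*} [NormedAddCommGroup Z] [NormedSpace ℝ Z]
  [NormedAddCommGroup V] [NormedSpace ℝ V] [NormedAddCommGroup F] [NormedSpace ℝ F]

/-- The partial derivative in the first variable. -/
def partialFDeriv (h : Z × V → F) (z : Z) (k : V) : Z →L[ℝ] F :=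
  (fderiv ℝ h (z, k)).comp (ContinuousLinearMap.inl ℝ Z V)

theorem continuous_partialFDeriv {h : Z × V → F} (hh : ContDiff ℝ 1 h) :
    Continuous (Function.uncurry (partialFDeriv h)) := by
  have : Continuous (fderiv ℝ h) := hh.continuous_fderiv one_ne_zero
  exact this.clm_comp (continuous_const (y := ContinuousLinearMap.inl ℝ Z V))

theorem hasFDerivAt_partialFDeriv {h : Z × V → F} (hh : ContDiff ℝ 1 h) (z : Z) (k : V) :
    HasFDerivAt (fun z => h (z, k)) (partialFDeriv h z k) z :=
  HasFDerivAt.comp (g := h) z (hh.differentiable one_ne_zero (z, k)).hasFDerivAt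
    (hasFDerivAt_prodMk_left z k)

theorem partialFDeriv_eq_zero {h : Z × V → F} (hh : ContDiff ℝ 1 h) {K : Set V}
    (h0 : ∀ z, ∀ k ∉ K, h (z, k) = 0) (z : Z) {k : V} (hk : k ∉ K) : partialFDeriv h z k = 0 := by
  refine (hasFDerivAt_partialFDeriv hh z k).unique ?_
  simp only [h0 _ k hk]
  exact hasFDerivAt_const _ _

variable [MeasurableSpace V] [BorelSpace V]
  {μ : Measure V} [IsLocallyFiniteMeasure μ]

theorem integrable_partialFDeriv {h : Z × V → F} (hh : ContDiff ℝ 1 h) {K : Set V}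
    (hK : IsCompact K) (h0 : ∀ z, ∀ k ∉ K, h (z, k) = 0) (z : Z) :
    Integrable (partialFDeriv h z) μ :=
  ((continuous_partialFDeriv hh).comp (Continuous.prodMk_right z)).integrable_of_hasCompactSupport
    (HasCompactSupport.intro hK fun _ hk => partialFDeriv_eq_zero hh h0 z hk)

variable [FiniteDimensional ℝ Z] [SecondCountableTopology V]

/-- On a unit ball around `z` the partial derivative is bounded by its maximum over a compact set,
and it vanishes for `k` outside `K`; this is an integrable dominating function. -/
theorem hasFDerivAt_integral_of_contDiff {h : Z × V → F} (hh : ContDiff ℝ 1 h) {K : Set V}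
    (hK : IsCompact K) (h0 : ∀ z, ∀ k ∉ K, h (z, k) = 0) (z : Z) :
    HasFDerivAt (fun z => ∫ k, h (z, k) ∂μ) (∫ k, partialFDeriv h z k ∂μ) z := by
  have hc := continuous_partialFDeriv hh
  obtain ⟨C, hC⟩ := ((isCompact_closedBall z 1).prod hK).exists_bound_of_continuousOn
    hc.continuousOn
  have hcont : ∀ z, Continuous fun k => h (z, k) := fun z =>
    hh.continuous.comp (Continuous.prodMk_right z)
  refine hasFDerivAt_integral_of_dominated_of_fderiv_le (bound := K.indicator fun _ => C)
    (Metric.closedBall_mem_nhds z one_pos)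
    (Filter.Eventually.of_forall fun z => (hcont z).aestronglyMeasurable)
    ((hcont z).integrable_of_hasCompactSupport (HasCompactSupport.intro hK (h0 z)))
    (integrable_partialFDeriv hh hK h0 z).aestronglyMeasurable
    (Filter.Eventually.of_forall fun k y hy => ?_) ?_
    (Filter.Eventually.of_forall fun k y _ => hasFDerivAt_partialFDeriv hh y k)
  · by_cases hk : k ∈ K
    · rw [Set.indicator_of_mem hk]
      exact hC (y, k) ⟨hy, hk⟩
    · rw [Set.indicator_of_notMem hk, partialFDeriv_eq_zero hh h0 y hk, norm_zero]
  · rw [integrable_indicator_iff hK.measurableSet]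
    exact integrableOn_const hK.measure_lt_top.ne

theorem contDiff_integral_of_contDiff {h : Z × V → F} (hh : ContDiff ℝ 1 h) {K : Set V}
    (hK : IsCompact K) (h0 : ∀ z, ∀ k ∉ K, h (z, k) = 0) :
    ContDiff ℝ 1 fun z => ∫ k, h (z, k) ∂μ := by
  have hd := hasFDerivAt_integral_of_contDiff (μ := μ) hh hK h0
  rw [contDiff_one_iff_fderiv]
  refine ⟨fun z => (hd z).differentiableAt, ?_⟩
  rw [funext fun z => (hd z).fderiv]
  refine (continuous_parametric_integral_of_continuous (μ := μ)
    (continuous_partialFDeriv hh) hK).congr fun z => ?_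
  exact setIntegral_eq_integral_of_forall_compl_eq_zero fun k hk =>
    partialFDeriv_eq_zero hh h0 z hk

end ParametricIntegral

/-! ### Exponentials of operators -/

section OperatorExp

theorem exp_zero_smul_apply {E : Type*} [NormedAddCommGroup E] [NormedSpace ℂ E]
    (X : E →L[ℂ] E) (v : E) :
    NormedSpace.exp (((0 : ℝ) : ℂ) • X) v = v := by
  simp

variable {E : Type*} [NormedAddCommGroup E] [NormedSpace ℂ E] [CompleteSpace E]

theorem contDiff_exp_apply {Z : Type*} [NormedAddCommGroup Z] [NormedSpace ℝ Z] {g : Z → E}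
    {X : Z → E →L[ℂ] E} (hg : ContDiff ℝ ∞ g) (hX : ContDiff ℝ ∞ X) :
    ContDiff ℝ ∞ fun z => NormedSpace.exp (X z) (g z) := by
  have hexp : ContDiff ℂ ∞ (fun X : E →L[ℂ] E => NormedSpace.exp X) :=
    contDiff_iff_contDiffAt.2 fun x => (NormedSpace.exp_analytic (𝕂 := ℂ) x).contDiffAt
  exact ((ContinuousLinearMap.restrictScalarsL ℂ E E ℝ ℝ).contDiff.comp
    ((hexp.restrict_scalars ℝ).comp hX)).clm_apply hg

theorem hasDerivAt_exp_apply (X : E →L[ℂ] E) (v : E) (t : ℝ) :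
    HasDerivAt (fun t : ℝ => NormedSpace.exp ((t : ℂ) • X) v)
      (X (NormedSpace.exp ((t : ℂ) • X) v)) t := by
  have h := (hasDerivAt_exp_smul_const' X (t : ℂ)).scomp t Complex.ofRealCLM.hasDerivAt
  have h' := ((ContinuousLinearMap.apply ℂ E v).restrictScalars ℝ).hasFDerivAt.comp_hasDerivAt t h
  exact h'.congr_deriv (by simp)

theorem exp_apply_eq_of_hasDerivAt {X : E →L[ℂ] E} {y : ℝ → E}
    (hy : ∀ t, HasDerivAt y (X (y t)) t) (t : ℝ) :
    NormedSpace.exp ((t : ℂ) • X) (y 0) = y t := by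
  have := ODE_solution_unique_univ (v := fun _ => X) (s := fun _ => Set.univ) (t₀ := 0)
    (f := fun t : ℝ => NormedSpace.exp ((t : ℂ) • X) (y 0)) (g := y)
    (fun _ => X.lipschitz.lipschitzOnWith) (fun t => ⟨hasDerivAt_exp_apply X (y 0) t, trivial⟩)
    (fun t => ⟨hy t, trivial⟩) (by simp)
  exact congrFun this t

/-- The exponential on a Jordan chain of length two. -/
theorem exp_apply_of_jordanChain {X : E →L[ℂ] E} {c d : ℂ} {v w : E} (hv : X v = c • v)
    (hw : X w = c • w + d • v) (t : ℝ) :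
    NormedSpace.exp ((t : ℂ) • X) w = Complex.exp (t * c) • (w + ((t : ℂ) * d) • v) := by
  have hy : ∀ t : ℝ, HasDerivAt (fun t : ℝ => Complex.exp (t * c) • (w + ((t : ℂ) * d) • v))
      (X (Complex.exp (t * c) • (w + ((t : ℂ) * d) • v))) t := by
    intro t
    have ho : HasDerivAt (fun s : ℝ => (s : ℂ)) 1 t := Complex.ofRealCLM.hasDerivAt
    have h4 := ((ho.mul_const c).cexp).smul (((ho.mul_const d).smul_const v).const_add w)
    refine HasDerivAt.congr_deriv (f := fun t : ℝ => _) h4 ?_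
    simp only [map_smul, map_add, hv, hw]
    module
  simpa using exp_apply_eq_of_hasDerivAt hy t

end OperatorExp

end

noncomputable section

/-! ### Complexified fields -/

/-- Complex values of the fields `(E_α, B^α)`. -/
abbrev ComplexEBField := EuclideanSpace ℂ (Fin 3 ⊕ Fin 3)

/-- A real matrix acting on the complexified fields. -/
def complexOp (A : Matrix (Fin 3 ⊕ Fin 3) (Fin 3 ⊕ Fin 3) ℝ) : ComplexEBField →L[ℂ] ComplexEBField :=
  Matrix.toEuclideanCLM (𝕜 := ℂ) (A.map Complex.ofReal)

theorem complexOp_apply (A : Matrix (Fin 3 ⊕ Fin 3) (Fin 3 ⊕ Fin 3) ℝ) (v : ComplexEBField)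
    (i : Fin 3 ⊕ Fin 3) : complexOp A v i = ∑ j, (A i j : ℂ) * v j := by
  simp [complexOp, Matrix.mulVec, dotProduct]

/-- The real part of the multiple `ζ v` of a complex field `v`. -/
def reMul (ζ : ℂ) : ComplexEBField →L[ℝ] EBField :=
  LinearMap.toContinuousLinearMap
    { toFun := fun v => WithLp.toLp 2 fun i => (ζ * v i).re
      map_add' := fun v w => by ext i; simp; ring
      map_smul' := fun c v => by ext i; simp; ring }

@[simp]
theorem reMul_apply (ζ : ℂ) (v : ComplexEBField) (i : Fin 3 ⊕ Fin 3) :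
    reMul ζ v i = (ζ * v i).re := rfl

theorem reMul_smul (ζ z : ℂ) (v : ComplexEBField) : reMul ζ (z • v) = reMul (ζ * z) v := by
  ext i
  simp only [reMul_apply, PiLp.smul_apply, smul_eq_mul, mul_assoc]

theorem reMul_complexOp (ζ : ℂ) (A : Matrix (Fin 3 ⊕ Fin 3) (Fin 3 ⊕ Fin 3) ℝ) (v : ComplexEBField) :
    (reMul ζ (complexOp A v)).ofLp = A.mulVec (reMul ζ v) := by
  ext i
  simp only [reMul_apply, complexOp_apply, Matrix.mulVec, dotProduct, Finset.mul_sum, Complex.re_sum]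
  refine Finset.sum_congr rfl fun j _ => ?_
  simp
  ring

/-- The factors `1` and `-i` select the real and imaginary parts. Well-posedness bounds real
solutions only, so bounds for complex amplitudes are obtained by adding these two. -/
theorem norm_sq_eq_reMul (v : ComplexEBField) :
    ‖v‖ ^ 2 = ‖reMul 1 v‖ ^ 2 + ‖reMul (-Complex.I) v‖ ^ 2 := by
  simp only [EuclideanSpace.norm_sq_eq, ← Finset.sum_add_distrib]
  refine Finset.sum_congr rfl fun i _ => ?_
  rw [← Complex.normSq_eq_norm_sq, Complex.normSq_apply]
  simp [sq]

/-- The complexification of a real field. -/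
def ofRealField (v : Fin 3 ⊕ Fin 3 → ℝ) : ComplexEBField := WithLp.toLp 2 fun i => (v i : ℂ)

theorem ofRealField_smul (c : ℝ) (v : Fin 3 ⊕ Fin 3 → ℝ) :
    ofRealField (c • v) = (c : ℂ) • ofRealField v := by
  ext i; simp [ofRealField]

theorem ofRealField_add (v w : Fin 3 ⊕ Fin 3 → ℝ) :
    ofRealField (v + w) = ofRealField v + ofRealField w := by
  ext i; simp [ofRealField]

theorem complexOp_ofRealField (A : Matrix (Fin 3 ⊕ Fin 3) (Fin 3 ⊕ Fin 3) ℝ) (v : Fin 3 ⊕ Fin 3 → ℝ) :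
    complexOp A (ofRealField v) = ofRealField (A.mulVec v) := by
  ext i; simp [complexOp_apply, ofRealField, Matrix.mulVec, dotProduct]

theorem reMul_ofRealField (ζ : ℂ) (v : Fin 3 ⊕ Fin 3 → ℝ) :
    (reMul ζ (ofRealField v)).ofLp = ζ.re • v := by
  ext i; simp [ofRealField]

theorem contDiff_ofRealField {Z : Type*} [NormedAddCommGroup Z] [NormedSpace ℝ Z]
    {g : Z → Fin 3 ⊕ Fin 3 → ℝ} (hg : ContDiff ℝ ∞ g) : ContDiff ℝ ∞ fun z => ofRealField (g z) := by
  have : ContDiff ℝ ∞ fun z => fun i => (g z i : ℂ) := contDiff_pi.2 fun i =>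
    Complex.ofRealCLM.contDiff.comp (contDiff_pi.1 hg i)
  exact (PiLp.contDiff_toLp (𝕜 := ℝ) (E := fun _ => ℂ)).comp this

/-! ### Constrained complex amplitudes -/

/-- The Fourier transformed constraints on the complex fields `b` at the spatial covector `k`. -/
def IsConstrainedC (G : Tensor4) (k : Fin 3 → ℝ) (b : ComplexEBField) : Prop :=
  ∀ ζ, IsConstrained G k (reMul ζ b)

theorem IsConstrainedC.smul {G : Tensor4} {k : Fin 3 → ℝ} {b : ComplexEBField}
    (hb : IsConstrainedC G k b) (z : ℂ) : IsConstrainedC G k (z • b) := fun ζ => by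
  rw [reMul_smul]
  exact hb _

theorem IsConstrained.smul {G : Tensor4} {k : Fin 3 → ℝ} {b : Fin 3 ⊕ Fin 3 → ℝ}
    (hb : IsConstrained G k b) (c : ℝ) : IsConstrained G k (c • b) := by
  simp [IsConstrained, hb.1, hb.2]

theorem isConstrained_smul_left {G : Tensor4} {k : Fin 3 → ℝ} {b : Fin 3 ⊕ Fin 3 → ℝ}
    (hb : IsConstrained G k b) (c : ℝ) : IsConstrained G (c • k) b := by
  simp [IsConstrained, hb.1, hb.2]

theorem isConstrainedC_ofRealField {G : Tensor4} {k : Fin 3 → ℝ} {b : Fin 3 ⊕ Fin 3 → ℝ}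
    (hb : IsConstrained G k b) : IsConstrainedC G k (ofRealField b) := fun ζ => by
  rw [reMul_ofRealField]
  exact hb.smul _

/-! ### Plane waves -/

theorem matC_eq_sum (G : Tensor4) (k : Fin 3 → ℝ) :
    matC G k = ∑ α, k α • matC G (Pi.single α 1) := by
  simp [matC, Matrix.mul_sum, Pi.single_apply, Finset.sum_ite_eq']

theorem matC_smul (G : Tensor4) (c : ℝ) (k : Fin 3 → ℝ) : matC G (c • k) = c • matC G k := by
  simp [matC, Matrix.mul_sum, Finset.smul_sum, smul_smul]

/-- The generator `-2πi C(k)` of the evolution of plane waves. -/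
def waveGenerator (G : Tensor4) (k : Space3) : ComplexEBField →L[ℂ] ComplexEBField :=
  (-(2 * Real.pi * Complex.I)) • complexOp (matC G k)

theorem contDiff_waveGenerator (G : Tensor4) : ContDiff ℝ ∞ (waveGenerator G) := by
  have : waveGenerator G = fun k : Space3 => ∑ α, (k α : ℝ) •
      ((-(2 * Real.pi * Complex.I)) • complexOp (matC G (Pi.single α 1))) := by
    ext k v i
    have hC : ∀ i j, matC G k i j = ∑ α, k α * matC G (Pi.single α 1) i j := fun i j => by
      rw [matC_eq_sum G k, Matrix.sum_apply]
      rfl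
    have hsum : ∀ L : Fin 3 → ComplexEBField →L[ℂ] ComplexEBField,
        (∑ α, L α) v i = ∑ α, L α v i := fun L => by simp
    simp only [waveGenerator, hsum, smul_apply, PiLp.smul_apply, complexOp_apply, hC,
      Complex.ofReal_sum, Complex.ofReal_mul, Finset.sum_mul, smul_eq_mul, Complex.real_smul,
      Finset.mul_sum]
    rw [Finset.sum_comm]
    refine Finset.sum_congr rfl fun α _ => Finset.sum_congr rfl fun j _ => ?_
    ring
  rw [this]
  fun_prop

/-- The Fourier amplitude at time `t` of the evolution with initial amplitude `g`. -/
def waveAmplitude (G : Tensor4) (g : Space3 → ComplexEBField) (t : ℝ) (k : Space3) : ComplexEBField :=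
  NormedSpace.exp ((t : ℂ) • waveGenerator G k) (g k)

/-- The plane wave with wave covector `k`. -/
def planeWave (G : Tensor4) (g : Space3 → ComplexEBField) (y : (ℝ × Space3) × Space3) :
    ComplexEBField :=
  Complex.exp (((-2 * Real.pi * inner ℝ y.2 y.1.2 : ℝ) : ℂ) * Complex.I) • waveAmplitude G g y.1.1 y.2

theorem contDiff_waveAmplitude (G : Tensor4) {g : Space3 → ComplexEBField} (hg : ContDiff ℝ ∞ g)
    {Z : Type*} [NormedAddCommGroup Z] [NormedSpace ℝ Z] {t : Z → ℝ} {k : Z → Space3}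
    (ht : ContDiff ℝ ∞ t) (hk : ContDiff ℝ ∞ k) :
    ContDiff ℝ ∞ fun z => waveAmplitude G g (t z) (k z) := by
  refine contDiff_exp_apply (hg.comp hk) ?_
  exact (Complex.ofRealCLM.contDiff.comp ht).smul ((contDiff_waveGenerator G).comp hk)

theorem contDiff_planeWave (G : Tensor4) {g : Space3 → ComplexEBField} (hg : ContDiff ℝ ∞ g) :
    ContDiff ℝ ∞ (planeWave G g) := by
  have h1 : ContDiff ℝ ∞ fun y : (ℝ × Space3) × Space3 => (-2 * Real.pi * inner ℝ y.2 y.1.2 : ℝ) :=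
    contDiff_const.mul (contDiff_snd.inner ℝ (contDiff_snd.comp contDiff_fst))
  have h2 : ContDiff ℝ ∞ fun y : (ℝ × Space3) × Space3 =>
      Complex.exp (((-2 * Real.pi * inner ℝ y.2 y.1.2 : ℝ) : ℂ) * Complex.I) :=
    ((Complex.ofRealCLM.contDiff.comp h1).mul contDiff_const).cexp
  exact h2.smul (contDiff_waveAmplitude G hg (contDiff_fst.comp contDiff_fst) contDiff_snd)

theorem waveAmplitude_eq_zero (G : Tensor4) {g : Space3 → ComplexEBField} (t : ℝ) {k : Space3}
    (hk : g k = 0) : waveAmplitude G g t k = 0 := by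
  rw [waveAmplitude, hk, map_zero]

theorem planeWave_eq_zero (G : Tensor4) {g : Space3 → ComplexEBField} (z : ℝ × Space3) {k : Space3}
    (hk : g k = 0) : planeWave G g (z, k) = 0 := by
  rw [planeWave, waveAmplitude_eq_zero G _ hk, smul_zero]

theorem waveAmplitude_zero (G : Tensor4) (g : Space3 → ComplexEBField) (k : Space3) :
    waveAmplitude G g 0 k = g k :=
  exp_zero_smul_apply _ _

theorem hasDerivAt_waveAmplitude (G : Tensor4) (g : Space3 → ComplexEBField) (k : Space3) (t : ℝ) :
    HasDerivAt (fun t => waveAmplitude G g t k) (waveGenerator G k (waveAmplitude G g t k)) t :=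
  hasDerivAt_exp_apply _ _ _

/-- The constraints are preserved by the evolution. -/
theorem isConstrainedC_waveAmplitude {G : Tensor4} (h : IsUnit (petrov G).det)
    (hs : (petrov G).IsSymm) (hn : IsNoncharacteristic G) {g : Space3 → ComplexEBField} {k : Space3}
    (hg : IsConstrainedC G k (g k)) (t : ℝ) : IsConstrainedC G k (waveAmplitude G g t k) := by
  intro ζ
  have hd : ∀ s, HasDerivAt (fun s => reMul ζ (waveAmplitude G g s k))
      (reMul ζ (waveGenerator G k (waveAmplitude G g s k))) s := fun s =>
    (reMul ζ).hasFDerivAt.comp_hasDerivAt s (hasDerivAt_waveAmplitude G g k s)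
  have hc : ∀ s, IsConstrained G k (reMul ζ (waveGenerator G k (waveAmplitude G g s k))) := by
    intro s
    rw [waveGenerator, smul_apply, reMul_smul, reMul_complexOp]
    exact isConstrained_matC_mulVec h hs hn _ _
  -- Each constraint is a linear functional of the amplitude, and its time derivative vanishes since
  -- the range of `C(k)` is constrained.
  have key : ∀ p : (Fin 3 ⊕ Fin 3 → ℝ) →ₗ[ℝ] ℝ,
      (∀ s, p (reMul ζ (waveGenerator G k (waveAmplitude G g s k))) = 0) →
      p (reMul ζ (g k)) = 0 → p (reMul ζ (waveAmplitude G g t k)) = 0 := by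
    intro p hp h0
    let p' : EBField →L[ℝ] ℝ := LinearMap.toContinuousLinearMap
      (p ∘ₗ (WithLp.linearEquiv 2 ℝ (Fin 3 ⊕ Fin 3 → ℝ)).toLinearMap)
    have hd' : ∀ s, HasDerivAt (fun s => p' (reMul ζ (waveAmplitude G g s k))) 0 s := fun s =>
      (p'.hasFDerivAt.comp_hasDerivAt s (hd s)).congr_deriv (hp s)
    have := is_const_of_deriv_eq_zero (fun s => (hd' s).differentiableAt) (fun s => (hd' s).deriv) t 0
    refine this.trans ?_
    beta_reduce
    rw [waveAmplitude_zero]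
    exact h0
  exact ⟨key (pairing (timeWedge k) ∘ₗ twoForm (volScale G)) (fun s => (hc s).1) (hg ζ).1,
    key (Matrix.toBilin' (petrov G)⁻¹ (timeWedge k) ∘ₗ twoForm (volScale G)) (fun s => (hc s).2)
      (hg ζ).2⟩

theorem partialFDeriv_eq_of_hasDerivAt {Z V F : Type*} [NormedAddCommGroup Z] [NormedSpace ℝ Z]
    [NormedAddCommGroup V] [NormedSpace ℝ V] [NormedAddCommGroup F] [NormedSpace ℝ F]
    {h : Z × V → F} (hh : ContDiff ℝ 1 h) (z v : Z) (k : V) {d : F}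
    (hd : HasDerivAt (fun s : ℝ => h (z + s • v, k)) d 0) : partialFDeriv h z k v = d := by
  have hline : HasDerivAt (fun s : ℝ => z + s • v) v 0 := by
    simpa using ((hasDerivAt_id (0 : ℝ)).smul_const v).const_add z
  have h1 : HasFDerivAt (fun z => h (z, k)) (partialFDeriv h z k) (z + (0 : ℝ) • v) := by
    simpa using hasFDerivAt_partialFDeriv hh z k
  exact (HasFDerivAt.comp_hasDerivAt (l := fun z => h (z, k)) 0 h1 hline).unique hd

theorem partialFDeriv_planeWave_time (G : Tensor4) {g : Space3 → ComplexEBField}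
    (hg : ContDiff ℝ ∞ g) (z : ℝ × Space3) (k : Space3) :
    partialFDeriv (planeWave G g) z k (coordVec 0) = waveGenerator G k (planeWave G g (z, k)) := by
  refine partialFDeriv_eq_of_hasDerivAt ((contDiff_planeWave G hg).of_le (mod_cast le_top)) _ _ _ ?_
  have h1 : HasDerivAt (fun s => waveAmplitude G g (z.1 + s) k)
      (waveGenerator G k (waveAmplitude G g z.1 k)) 0 := by
    have := hasDerivAt_waveAmplitude G g k (z.1 + 0)
    simpa using this.comp_const_add z.1 0
  have h2 := h1.const_smul
    (Complex.exp (((-2 * Real.pi * inner ℝ k z.2 : ℝ) : ℂ) * Complex.I))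
  rw [← map_smul] at h2
  refine h2.congr_of_eventuallyEq (Filter.Eventually.of_forall fun s => ?_)
  simp [planeWave, coordVec]

theorem partialFDeriv_planeWave_space (G : Tensor4) {g : Space3 → ComplexEBField}
    (hg : ContDiff ℝ ∞ g) (z : ℝ × Space3) (k : Space3) (α : Fin 3) :
    partialFDeriv (planeWave G g) z k (coordVec α.succ) =
      (-(2 * Real.pi * Complex.I) * k α) • planeWave G g (z, k) := by
  refine partialFDeriv_eq_of_hasDerivAt ((contDiff_planeWave G hg).of_le (mod_cast le_top)) _ _ _ ?_
  have h1 : HasDerivAt (fun s : ℝ => Complex.exp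
      (((-2 * Real.pi * (inner ℝ k z.2 + s * k α) : ℝ) : ℂ) * Complex.I))
      (Complex.exp (((-2 * Real.pi * inner ℝ k z.2 : ℝ) : ℂ) * Complex.I) *
        (-(2 * Real.pi * Complex.I) * k α)) 0 := by
    have h2 : HasDerivAt (fun s : ℝ => -2 * Real.pi * (inner ℝ k z.2 + s * k α))
        (-2 * Real.pi * (1 * k α)) 0 :=
      (((hasDerivAt_id (0 : ℝ)).mul_const (k α)).const_add _).const_mul _
    refine ((h2.ofReal_comp.mul_const Complex.I).cexp).congr_deriv ?_
    simp
    ring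
  have h2 := h1.smul_const (waveAmplitude G g z.1 k)
  refine (h2.congr_deriv ?_).congr_of_eventuallyEq (Filter.Eventually.of_forall fun s => ?_)
  · simp only [planeWave, smul_smul]
    ring_nf
  · simp [planeWave, coordVec, inner_add_right, inner_smul_right, EuclideanSpace.inner_single_right]

end

noncomputable section

/-! ### Superpositions of plane waves solve Maxwell's equations -/

open MeasureTheory

/-- The field strength as a linear function of the fields. -/
def fieldStrengthCLM (G : Tensor4) (c d : Fin 4) : EBField →L[ℝ] ℝ :=
  LinearMap.toContinuousLinearMap
    { toFun := fun v => fieldStrength G v c d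
      map_add' := fun v w => by
        simp only [fieldStrength, PiLp.add_apply, ← Finset.sum_add_distrib]
        exact Finset.sum_congr rfl fun α _ => by ring
      map_smul' := fun r v => by
        simp only [fieldStrength, PiLp.smul_apply, smul_eq_mul, Finset.mul_sum, RingHom.id_apply]
        exact Finset.sum_congr rfl fun α _ => by ring }

theorem pderiv4_fieldStrength (G : Tensor4) {u : ℝ × Space3 → EBField} {z : ℝ × Space3}
    (hu : DifferentiableAt ℝ u z) (b c d : Fin 4) :
    pderiv4 b (fun y => fieldStrength G (u y) c d) z =
      ∑ A, twoForm (volScale G) (fderiv ℝ u z (coordVec b)).ofLp A * petrovSign A c d := by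
  rw [← fieldStrength_eq]
  have := ((fieldStrengthCLM G c d).hasFDerivAt.comp z hu.hasFDerivAt).fderiv
  exact congrArg (fun L => L (coordVec b)) this

/-- The symbol of `K^{abcd} ∂_b F_{cd}` as a linear function of the derivative of the fields. -/
def symbCLM (c : ℝ) (K : Matrix (Fin 6) (Fin 6) ℝ) (a : Fin 4) :
    (ℝ × Space3 →L[ℝ] EBField) →L[ℝ] ℝ :=
  LinearMap.toContinuousLinearMap
    { toFun := fun L => symb K (fun b => twoForm c (L (coordVec b)).ofLp) a
      map_add' := fun L M => by
        rw [← symb_add]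
        congr 1
        ext1 b
        exact map_add (twoForm c) _ _
      map_smul' := fun r L => by
        have : (fun b => twoForm c ((r • L) (coordVec b)).ofLp) =
            fun b => r • twoForm c (L (coordVec b)).ofLp := by
          ext1 b
          exact map_smul (twoForm c) _ _
        rw [this]
        simp only [symb, Matrix.mulVec_smul, Pi.smul_apply, smul_eq_mul, Finset.mul_sum,
          RingHom.id_apply]
        exact Finset.sum_congr rfl fun b _ => Finset.sum_congr rfl fun A _ => by ring }

theorem maxwellOne_eq {G : Tensor4} (h : IsUnit (petrov G).det) {u : ℝ × Space3 → EBField}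
    {z : ℝ × Space3} (hu : DifferentiableAt ℝ u z) (a : Fin 4) : maxwellOne G u z a =
      2 * symbCLM (volScale G) ((volScale G)⁻¹ • petrovEps) a (fderiv ℝ u z) := by
  simp only [maxwellOne, pderiv4_fieldStrength G hu, invTensor,
    inv_petrov_volForm h]
  exact sum_unpetrov_mul _ (fun b => twoForm (volScale G) (fderiv ℝ u z (coordVec b)).ofLp) a

theorem maxwellTwo_eq {G : Tensor4} {u : ℝ × Space3 → EBField}
    {z : ℝ × Space3} (hu : DifferentiableAt ℝ u z) (a : Fin 4) : maxwellTwo G u z a =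
      2 * symbCLM (volScale G) (petrov G)⁻¹ a (fderiv ℝ u z) := by
  simp only [maxwellTwo, pderiv4_fieldStrength G hu, invTensor]
  exact sum_unpetrov_mul _ (fun b => twoForm (volScale G) (fderiv ℝ u z (coordVec b)).ofLp) a

/-- The superposition of plane waves with initial amplitude `g`. -/
def wavePacket (G : Tensor4) (g : Space3 → ComplexEBField) (z : ℝ × Space3) : ComplexEBField :=
  ∫ k, planeWave G g (z, k)

theorem partialFDeriv_reMul_planeWave (G : Tensor4) {g : Space3 → ComplexEBField}
    (hg : ContDiff ℝ ∞ g) (ζ : ℂ) (z : ℝ × Space3) (k : Space3) (b : Fin 4) :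
    (partialFDeriv (fun y => reMul ζ (planeWave G g y)) z k (coordVec b)).ofLp =
      (Fin.cons ((matC G k).mulVec (reMul (ζ * -(2 * Real.pi * Complex.I)) (planeWave G g (z, k))))
        fun α => k α • (reMul (ζ * -(2 * Real.pi * Complex.I)) (planeWave G g (z, k))).ofLp :
        Fin 4 → Fin 3 ⊕ Fin 3 → ℝ) b := by
  have h1 : ContDiff ℝ 1 (planeWave G g) := (contDiff_planeWave G hg).of_le (mod_cast le_top)
  have h2 : partialFDeriv (fun y => reMul ζ (planeWave G g y)) z k =
      (reMul ζ).comp (partialFDeriv (planeWave G g) z k) :=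
    (hasFDerivAt_partialFDeriv ((reMul ζ).contDiff.comp h1) z k).unique
      ((reMul ζ).hasFDerivAt.comp z (hasFDerivAt_partialFDeriv h1 z k))
  rw [h2, ContinuousLinearMap.comp_apply]
  refine Fin.cases ?_ (fun α => ?_) b
  · rw [partialFDeriv_planeWave_time G hg, Fin.cons_zero, waveGenerator, smul_apply, reMul_smul,
      reMul_complexOp]
  · rw [partialFDeriv_planeWave_space G hg, Fin.cons_succ, reMul_smul]
    ext i
    simp only [reMul_apply, Pi.smul_apply, smul_eq_mul]
    rw [← Complex.re_ofReal_mul]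
    ring_nf

theorem isConstrainedC_planeWave {G : Tensor4} (h : IsUnit (petrov G).det)
    (hs : (petrov G).IsSymm) (hn : IsNoncharacteristic G) {g : Space3 → ComplexEBField} {k : Space3}
    (hg : IsConstrainedC G k (g k)) (z : ℝ × Space3) : IsConstrainedC G k (planeWave G g (z, k)) :=
  (isConstrainedC_waveAmplitude h hs hn hg z.1).smul _

theorem symbCLM_partialFDeriv {G : Tensor4} (h : IsUnit (petrov G).det)
    (hs : (petrov G).IsSymm) (hn : IsNoncharacteristic G) {g : Space3 → ComplexEBField}
    (hg : ContDiff ℝ ∞ g) (hc : ∀ k : Space3, IsConstrainedC G k (g k)) (ζ : ℂ) (z : ℝ × Space3)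
    (k : Space3) (a : Fin 4) :
    symbCLM (volScale G) ((volScale G)⁻¹ • petrovEps) a
        (partialFDeriv (fun y => reMul ζ (planeWave G g y)) z k) = 0 ∧
      symbCLM (volScale G) (petrov G)⁻¹ a
        (partialFDeriv (fun y => reMul ζ (planeWave G g y)) z k) = 0 := by
  have := maxwellSymbolVanishes_of_isConstrained h hs hn
    (isConstrainedC_planeWave h hs hn (hc k) z (ζ * -(2 * Real.pi * Complex.I))) a
  simp only [← partialFDeriv_reMul_planeWave G hg] at this
  exact this

theorem integrable_planeWave (G : Tensor4) {g : Space3 → ComplexEBField} (hg : ContDiff ℝ ∞ g)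
    (hsupp : HasCompactSupport g) (z : ℝ × Space3) :
    Integrable fun k => planeWave G g (z, k) :=
  ((contDiff_planeWave G hg).continuous.comp (Continuous.prodMk_right z)).integrable_of_hasCompactSupport
    (HasCompactSupport.intro hsupp fun _ hk => planeWave_eq_zero G z (image_eq_zero_of_notMem_tsupport hk))

theorem reMul_wavePacket (G : Tensor4) {g : Space3 → ComplexEBField} (hg : ContDiff ℝ ∞ g)
    (hsupp : HasCompactSupport g) (ζ : ℂ) (z : ℝ × Space3) :
    reMul ζ (wavePacket G g z) = ∫ k, reMul ζ (planeWave G g (z, k)) :=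
  ((reMul ζ).integral_comp_comm (integrable_planeWave G hg hsupp z)).symm

section

variable {G : Tensor4} {g : Space3 → ComplexEBField}

theorem contDiff_reMul_wavePacket (hg : ContDiff ℝ ∞ g) (hsupp : HasCompactSupport g) (ζ : ℂ) :
    ContDiff ℝ 1 fun z => reMul ζ (wavePacket G g z) := by
  have h1 : ContDiff ℝ 1 (planeWave G g) := (contDiff_planeWave G hg).of_le (mod_cast le_top)
  rw [funext (reMul_wavePacket G hg hsupp ζ)]
  exact contDiff_integral_of_contDiff ((reMul ζ).contDiff.comp h1) hsupp fun z k hk => by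
    simp only [Function.comp, planeWave_eq_zero G z (image_eq_zero_of_notMem_tsupport hk), map_zero]

theorem clm_fderiv_reMul_wavePacket (hg : ContDiff ℝ ∞ g) (hsupp : HasCompactSupport g) (ζ : ℂ)
    (L : (ℝ × Space3 →L[ℝ] EBField) →L[ℝ] ℝ) (z : ℝ × Space3) :
    L (fderiv ℝ (fun z => reMul ζ (wavePacket G g z)) z) =
      ∫ k, L (partialFDeriv (fun y => reMul ζ (planeWave G g y)) z k) := by
  have h1 : ContDiff ℝ 1 fun y => reMul ζ (planeWave G g y) :=
    (reMul ζ).contDiff.comp ((contDiff_planeWave G hg).of_le (mod_cast le_top))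
  have h0 : ∀ z, ∀ k ∉ tsupport g, reMul ζ (planeWave G g (z, k)) = 0 := fun z k hk => by
    rw [planeWave_eq_zero G z (image_eq_zero_of_notMem_tsupport hk), map_zero]
  rw [L.integral_comp_comm (integrable_partialFDeriv h1 hsupp h0 z),
    funext (reMul_wavePacket G hg hsupp ζ), (hasFDerivAt_integral_of_contDiff h1 hsupp h0 z).fderiv]

/-- At fixed time the wave packet is the Fourier transform of a Schwartz function. -/
theorem exists_schwartz_wavePacket (hg : ContDiff ℝ ∞ g) (hsupp : HasCompactSupport g) (t : ℝ) :
    ∃ f : 𝓢(Space3, ComplexEBField), (⇑f = waveAmplitude G g t) ∧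
      (⇑(FourierTransform.fourier f) = fun x => wavePacket G g (t, x)) := by
  have h1 : HasCompactSupport (waveAmplitude G g t) :=
    HasCompactSupport.intro hsupp fun _ hk =>
      waveAmplitude_eq_zero G t (image_eq_zero_of_notMem_tsupport hk)
  refine ⟨h1.toSchwartzMap (contDiff_waveAmplitude G hg contDiff_const contDiff_id), rfl, ?_⟩
  rw [SchwartzMap.fourier_coe]
  ext1 x
  rw [Real.fourier_eq']
  rfl

theorem memLp_wavePacket (hg : ContDiff ℝ ∞ g) (hsupp : HasCompactSupport g) (t : ℝ) :
    MemLp (fun x => wavePacket G g (t, x)) 2 := by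
  obtain ⟨f, -, hf⟩ := exists_schwartz_wavePacket (G := G) hg hsupp t
  rw [← hf]
  exact SchwartzMap.memLp _ 2 volume

theorem integral_norm_sq_wavePacket (hg : ContDiff ℝ ∞ g) (hsupp : HasCompactSupport g) (t : ℝ) :
    ∫ x, ‖wavePacket G g (t, x)‖ ^ 2 = ∫ k, ‖waveAmplitude G g t k‖ ^ 2 := by
  obtain ⟨f, hf, hf'⟩ := exists_schwartz_wavePacket (G := G) hg hsupp t
  have := SchwartzMap.integral_norm_sq_fourier f
  rwa [hf', hf] at this

theorem memLp_reMul_wavePacket (hg : ContDiff ℝ ∞ g) (hsupp : HasCompactSupport g) (ζ : ℂ) (t : ℝ) :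
    MemLp (fun x => reMul ζ (wavePacket G g (t, x))) 2 :=
  (reMul ζ).comp_memLp' (memLp_wavePacket hg hsupp t)

theorem isMaxwellSolution_wavePacket (h : IsUnit (petrov G).det) (hs : (petrov G).IsSymm)
    (hn : IsNoncharacteristic G) (hg : ContDiff ℝ ∞ g) (hsupp : HasCompactSupport g)
    (hc : ∀ k : Space3, IsConstrainedC G k (g k)) (ζ : ℂ) (τ : ℝ) :
    IsMaxwellSolution G τ fun z => reMul ζ (wavePacket G g z) where
  contDiff := contDiff_reMul_wavePacket hg hsupp ζ
  memLp t _ := memLp_reMul_wavePacket hg hsupp ζ t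
  eqOne t _ x a := by
    rw [maxwellOne_eq h ((contDiff_reMul_wavePacket hg hsupp ζ).differentiable one_ne_zero _),
      clm_fderiv_reMul_wavePacket hg hsupp]
    simp only [(symbCLM_partialFDeriv h hs hn hg hc ζ _ _ a).1, integral_zero, mul_zero]
  eqTwo t _ x a := by
    rw [maxwellTwo_eq ((contDiff_reMul_wavePacket hg hsupp ζ).differentiable one_ne_zero _),
      clm_fderiv_reMul_wavePacket hg hsupp]
    simp only [(symbCLM_partialFDeriv h hs hn hg hc ζ _ _ a).2, integral_zero, mul_zero]

end

end

noncomputable section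

/-! ### Growth of wave packets and failure of well-posedness -/

open MeasureTheory

theorem integral_norm_sq_le_of_eLpNorm_le {α F : Type*} [MeasurableSpace α] {μ : Measure α}
    [NormedAddCommGroup F] {f g : α → F} (hf : MemLp f 2 μ) (hg : MemLp g 2 μ) {K : ℝ≥0}
    (hfg : eLpNorm f 2 μ ≤ K * eLpNorm g 2 μ) :
    ∫ x, ‖f x‖ ^ 2 ∂μ ≤ (K : ℝ) ^ 2 * ∫ x, ‖g x‖ ^ 2 ∂μ := by
  have key : ∀ {f : α → F}, MemLp f 2 μ →
      ENNReal.ofReal (∫ x, ‖f x‖ ^ 2 ∂μ) = eLpNorm f 2 μ ^ 2 := fun {f} hf => by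
    rw [hf.eLpNorm_eq_integral_rpow_norm two_ne_zero ENNReal.ofNat_ne_top,
      ← ENNReal.ofReal_pow (Real.rpow_nonneg (integral_nonneg fun _ => by positivity) _)]
    have h0 : 0 ≤ ∫ x, ‖f x‖ ^ 2 ∂μ := integral_nonneg fun _ => by positivity
    simp [← Real.sqrt_eq_rpow, Real.sq_sqrt h0, ← one_div]
  have h := pow_le_pow_left' hfg 2
  rw [mul_pow, ← key hf, ← key hg, ← ENNReal.coe_pow, ← ENNReal.ofReal_coe_nnreal,
    ← ENNReal.ofReal_mul (NNReal.coe_nonneg _)] at h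
  have h' := (ENNReal.ofReal_le_ofReal_iff
    (mul_nonneg (NNReal.coe_nonneg _) (integral_nonneg fun _ => by positivity))).1 h
  simpa using h'

theorem integral_norm_sq_eq_reMul {α : Type*} [MeasurableSpace α] {μ : Measure α}
    {w : α → ComplexEBField} (hw : MemLp w 2 μ) : ∫ x, ‖w x‖ ^ 2 ∂μ =
      ∫ x, ‖reMul 1 (w x)‖ ^ 2 ∂μ + ∫ x, ‖reMul (-Complex.I) (w x)‖ ^ 2 ∂μ := by
  have h : ∀ ζ, Integrable (fun x => ‖reMul ζ (w x)‖ ^ 2) μ := fun ζ =>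
    ((reMul ζ).comp_memLp' hw).integrable_norm_pow two_ne_zero
  rw [← integral_add (h 1) (h _)]
  simp only [norm_sq_eq_reMul]

variable {G : Tensor4}

/-- Continuous dependence on the data bounds the evolution of the Fourier amplitudes. -/
theorem integral_norm_sq_waveAmplitude_le (h : IsUnit (petrov G).det) (hs : (petrov G).IsSymm)
    (hn : IsNoncharacteristic G) {τ : ℝ} (hτ : 0 ≤ τ) {K : ℝ≥0}
    (hK : ∀ u, IsMaxwellSolution G τ u → ∀ t ∈ Set.Icc 0 τ,
      eLpNorm (fun x => u (t, x)) 2 volume ≤ K * eLpNorm (fun x => u (0, x)) 2 volume)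
    {g : Space3 → ComplexEBField} (hg : ContDiff ℝ ∞ g) (hsupp : HasCompactSupport g)
    (hc : ∀ k : Space3, IsConstrainedC G k (g k)) :
    ∫ k, ‖waveAmplitude G g τ k‖ ^ 2 ≤ (K : ℝ) ^ 2 * ∫ k, ‖g k‖ ^ 2 := by
  have hb : ∀ ζ, ∫ x, ‖reMul ζ (wavePacket G g (τ, x))‖ ^ 2 ≤
      (K : ℝ) ^ 2 * ∫ x, ‖reMul ζ (wavePacket G g (0, x))‖ ^ 2 := fun ζ =>
    integral_norm_sq_le_of_eLpNorm_le (memLp_reMul_wavePacket hg hsupp ζ τ)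
      (memLp_reMul_wavePacket hg hsupp ζ 0)
      (hK _ (isMaxwellSolution_wavePacket h hs hn hg hsupp hc ζ τ) τ ⟨hτ, le_rfl⟩)
  have h0 : ∫ k, ‖g k‖ ^ 2 = ∫ k, ‖waveAmplitude G g 0 k‖ ^ 2 := by
    simp only [waveAmplitude_zero]
  -- Plancherel is used at times `0` and `τ`, and the norms are split into real and imaginary parts,
  -- each of which is a Maxwell solution.
  rw [h0, ← integral_norm_sq_wavePacket hg hsupp, ← integral_norm_sq_wavePacket hg hsupp,
    integral_norm_sq_eq_reMul (memLp_wavePacket hg hsupp τ),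
    integral_norm_sq_eq_reMul (memLp_wavePacket hg hsupp 0), mul_add]
  exact add_le_add (hb _) (hb _)

/-- Polarized amplitudes on a Jordan chain grow by arbitrarily large factors at high frequency. -/
theorem exists_growth {k : Fin 3 → ℝ} {s : ℝ} {u₁ u₂ : Fin 3 ⊕ Fin 3 → ℝ} (hu : u₁ ≠ 0)
    (h₁ : (matC G k).mulVec u₁ = s • u₁) (h₂ : (matC G k).mulVec u₂ = s • u₂ + u₁) {τ : ℝ}
    (hτ : 0 < τ) (K : ℝ≥0) : ∃ n : ℝ, 0 < n ∧
      K * ‖ofRealField u₂‖ < ‖NormedSpace.exp ((τ : ℂ) •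
        waveGenerator G (WithLp.toLp 2 (n • k))) (ofRealField u₂)‖ := by
  have hu' : 0 < ‖ofRealField u₁‖ := by
    rw [norm_pos_iff]
    intro h0
    refine hu (funext fun i => ?_)
    simpa [ofRealField] using congrArg (fun v : ComplexEBField => v i) h0
  set a := ‖ofRealField u₁‖
  set b := ‖ofRealField u₂‖ with hb
  have hπ := Real.pi_pos
  have hb0 : 0 ≤ b := norm_nonneg _
  have hKb : 0 ≤ (K : ℝ) * b := by positivity
  -- The frequency is chosen so that the secular term has norm `(K + 1) b + 1`. Subtracting the norm
  -- `b` of the initial amplitude still leaves more than `K b`.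
  refine ⟨((K + 1) * b + 1) / (2 * Real.pi * τ * a), by positivity, ?_⟩
  set n : ℝ := ((K + 1) * b + 1) / (2 * Real.pi * τ * a) with hn
  have hn0 : 0 < n := by positivity
  have hna : 2 * Real.pi * τ * a * n = (K + 1) * b + 1 := by
    rw [hn]; field_simp
  have hgen : ∀ v, waveGenerator G (WithLp.toLp 2 (n • k)) (ofRealField v) =
      (-(2 * Real.pi * Complex.I) * n) • ofRealField ((matC G k).mulVec v) := fun v => by
    rw [waveGenerator, smul_apply, complexOp_ofRealField, mul_smul, ← ofRealField_smul, matC_smul,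
      Matrix.smul_mulVec]
  rw [exp_apply_of_jordanChain (c := -(2 * Real.pi * Complex.I) * n * s)
    (d := -(2 * Real.pi * Complex.I) * n) (v := ofRealField u₁)
    (by rw [hgen, h₁, ofRealField_smul, smul_smul])
    (by rw [hgen, h₂, ofRealField_add, ofRealField_smul, smul_add, smul_smul]), norm_smul]
  -- The eigenvalue `s` is real, so the exponential is a pure phase and all growth comes from the
  -- nilpotent part.
  have hexp : ‖Complex.exp (τ * (-(2 * Real.pi * Complex.I) * n * s))‖ = 1 := by
    have : (τ : ℂ) * (-(2 * Real.pi * Complex.I) * n * s) =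
        ((-(2 * Real.pi * τ * n * s) : ℝ) : ℂ) * Complex.I := by push_cast; ring
    rw [this, Complex.norm_exp_ofReal_mul_I]
  have hnorm : ‖((τ : ℂ) * (-(2 * Real.pi * Complex.I) * n)) • ofRealField u₁‖ =
      2 * Real.pi * τ * a * n := by
    rw [norm_smul]
    simp only [norm_mul, norm_neg, Complex.norm_real, Complex.norm_I, Real.norm_eq_abs,
      abs_of_pos hτ, abs_of_pos hπ, abs_of_pos hn0, Complex.norm_ofNat]
    ring
  rw [hexp, one_mul]
  have htri := norm_sub_le (ofRealField u₂ + ((τ : ℂ) * (-(2 * Real.pi * Complex.I) * n)) •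
    ofRealField u₁) (ofRealField u₂)
  rw [add_sub_cancel_left, hnorm, hna, ← hb] at htri
  linarith

theorem not_isCauchyWellPosed_of_jordanChain (h : IsUnit (petrov G).det) (hs : (petrov G).IsSymm)
    (hn : IsNoncharacteristic G) {k : Fin 3 → ℝ} {s : ℝ} {u₁ u₂ : Fin 3 ⊕ Fin 3 → ℝ} (hu : u₁ ≠ 0)
    (h₁ : (matC G k).mulVec u₁ = s • u₁) (h₂ : (matC G k).mulVec u₂ = s • u₂ + u₁)
    (hc : IsConstrained G k u₂) : ¬ IsCauchyWellPosed G := by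
  rintro ⟨-, τ, hτ, -, -, K, hK⟩
  obtain ⟨n, hn0, hgrowth⟩ := exists_growth hu h₁ h₂ hτ K
  -- `C(0) = 0` has no Jordan chain. A nonzero wave covector is needed to extend the amplitude
  -- within the constraints.
  have hk : k ≠ 0 := by
    rintro rfl
    have h0 : matC G 0 = 0 := by simp [matC]
    rw [h0, Matrix.zero_mulVec] at h₁ h₂
    have hs0 : s = 0 := (smul_eq_zero.1 h₁.symm).resolve_right hu
    rw [hs0, zero_smul, zero_add] at h₂
    exact hu h₂.symm
  obtain ⟨g₀, hg₀, hgc, ρ, hρ, hgk⟩ := exists_constrained_extension h hn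
    (smul_ne_zero hn0.ne' hk) (isConstrained_smul_left hc n)
  set κ : Space3 := WithLp.toLp 2 (n • k) with hκ
  set γ : Space3 → ComplexEBField := fun q => ofRealField (g₀ q.ofLp) with hγ
  have hγs : ContDiff ℝ ∞ γ :=
    contDiff_ofRealField (hg₀.comp (PiLp.contDiff_ofLp (𝕜 := ℝ) (E := fun _ => ℝ)))
  have hAc : Continuous (waveAmplitude G γ τ) :=
    (contDiff_waveAmplitude G hγs contDiff_const contDiff_id).continuous
  set S : Space3 → ℝ := fun q => ‖waveAmplitude G γ τ q‖ ^ 2 - (K : ℝ) ^ 2 * ‖γ q‖ ^ 2 with hS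
  have hSc : Continuous S :=
    (hAc.norm.pow 2).sub (continuous_const.mul (hγs.continuous.norm.pow 2))
  have hγκ : γ κ = (ρ : ℂ) • ofRealField u₂ := by
    rw [← ofRealField_smul, ← hgk]
  have hSκ : 0 < S κ := by
    have h1 : waveAmplitude G γ τ κ =
        (ρ : ℂ) • NormedSpace.exp ((τ : ℂ) • waveGenerator G κ) (ofRealField u₂) := by
      rw [waveAmplitude, hγκ, map_smul]
    simp only [hS]
    rw [h1, hγκ, norm_smul, norm_smul, sub_pos, ← mul_pow]
    refine pow_lt_pow_left₀ ?_ (by positivity) two_ne_zero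
    have hρ' : 0 < ‖(ρ : ℂ)‖ := norm_pos_iff.2 (Complex.ofReal_ne_zero.2 hρ)
    calc (K : ℝ) * (‖(ρ : ℂ)‖ * ‖ofRealField u₂‖) = ‖(ρ : ℂ)‖ * (K * ‖ofRealField u₂‖) := by ring
      _ < _ := mul_lt_mul_of_pos_left hgrowth hρ'
  -- By continuity the excess over the bound `K` persists on a ball around `κ`. Amplitudes cut off
  -- to this ball contradict the integrated estimate, since the cutoff is a scalar and commutes with
  -- the evolution at each frequency.
  obtain ⟨r, hr, hball⟩ := Metric.isOpen_iff.1 (isOpen_lt continuous_const hSc) κ hSκ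
  let φ : ContDiffBump κ := ⟨r / 2, r, by positivity, by linarith⟩
  set g : Space3 → ComplexEBField := fun q => ((φ q : ℝ) : ℂ) • γ q with hgdef
  have hφs : ContDiff ℝ ∞ fun q => ((φ q : ℝ) : ℂ) := Complex.ofRealCLM.contDiff.comp φ.contDiff
  have hgs : ContDiff ℝ ∞ g := hφs.smul hγs
  have hgsupp : HasCompactSupport g := φ.hasCompactSupport.mono fun q hq hφq => hq (by
    simp [hgdef, hφq])
  have hle := integral_norm_sq_waveAmplitude_le h hs hn hτ.le hK hgs hgsupp fun q =>
    (isConstrainedC_ofRealField (hgc q.ofLp)).smul _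
  have hamp : ∀ q, waveAmplitude G g τ q = ((φ q : ℝ) : ℂ) • waveAmplitude G γ τ q := fun q => by
    simp only [waveAmplitude, hgdef, map_smul]
  have hnormφ : ∀ q (v : ComplexEBField), ‖((φ q : ℝ) : ℂ) • v‖ ^ 2 = φ q ^ 2 * ‖v‖ ^ 2 :=
    fun q v => by rw [norm_smul, mul_pow, Complex.norm_real, Real.norm_eq_abs, sq_abs]
  have hint : ∀ {v : Space3 → ComplexEBField}, Continuous v →
      Integrable fun q => φ q ^ 2 * ‖v q‖ ^ 2 := fun {v} hv =>
    ((φ.continuous.pow 2).mul (hv.norm.pow 2)).integrable_of_hasCompactSupport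
      (φ.hasCompactSupport.mono fun q hq hφq => hq (by simp [hφq]))
  simp only [hamp] at hle
  simp only [hgdef, hnormφ] at hle
  rw [← integral_const_mul, ← sub_nonpos,
    ← integral_sub (hint hAc) ((hint hγs.continuous).const_mul _)] at hle
  have hpos : 0 < ∫ q, φ q ^ 2 * S q := by
    refine Continuous.integral_pos_of_hasCompactSupport_nonneg_nonzero (x := κ)
      ((φ.continuous.pow 2).mul hSc)
      (φ.hasCompactSupport.mono fun q hq hφq => hq (by simp [hφq])) (fun q => ?_) ?_
    · by_cases hq : q ∈ Metric.ball κ r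
      · exact mul_nonneg (sq_nonneg _) (le_of_lt (hball hq))
      · have : φ q = 0 := φ.zero_of_le_dist (by simpa using hq)
        simp [this]
    · have : φ κ = 1 := φ.one_of_mem_closedBall (Metric.mem_closedBall_self φ.rIn_pos.le)
      simp only [this]
      linarith
  refine absurd hle (not_le.2 (hpos.trans_eq (integral_congr_ae (Filter.Eventually.of_forall
    fun q => ?_))))
  simp only [hS]
  ring

end

/-! ### The main theorem -/

theorem theorem4p1 {M : Type*} [TopologicalSpace M] [T2Space M] [SecondCountableTopology M]
    [ChartedSpace (EuclideanSpace ℝ (Fin 4)) M] [IsManifold (𝓡 4) ∞ M]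
    (G : AreaMetric M) (p : M) (hp : G.IsMetaclassVIIItoXXIIIAt p) :
    ¬ G.IsMaxwellWellPosedAt p ∧
      ∀ e : Module.Basis (Fin 4) ℝ (TangentSpace (𝓡 4) p),
        IsNoncharacteristic (G.components p e) →
          ∃ k : Fin 3 → ℝ, ¬ IsDiagonalizableOverC (matC (G.components p e) k) := by
  refine ⟨?_, fun e hn => ?_⟩
  · rintro ⟨e, he⟩
    obtain ⟨k, s, u₁, u₂, hu, h₁, h₂, hc⟩ := G.exists_jordanChain p hp e he.1
    exact not_isCauchyWellPosed_of_jordanChain (G.invertible p e) (G.isSymm_petrov p e) he.1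
      hu h₁ h₂ hc he
  · obtain ⟨k, s, u₁, u₂, hu, h₁, h₂, -⟩ := G.exists_jordanChain p hp e hn
    exact ⟨k, not_isDiagonalizableOverC_of_jordanChain hu h₁ h₂⟩
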